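/- For an open set $\omega\subset\mathbb R^2$ let $L^N_\omega=-\Delta$ be the Neumann Laplacian in the complex space $L^2(\omega)$, with domain $\{u\in H^1(\omega):\Delta u\in L^2(\omega),\ \partial_{\mathbf n}u=0\}$, where $-\Delta u=w$ together with $\partial_{\mathbf n}u=0$ means, in the usual weak sense, $\int_\omega\nabla u\cdot\overline{\nabla v}\,\mathrm d\mathbf y=\int_\omega w\,\overline v\,\mathrm d\mathbf y$ for all $v\in H^1(\omega)$. Let $\lambda_1^N(\omega)\le\lambda_2^N(\omega)\le\dots$ be its eigenvalues, counted with multiplicity. For $\psi$ in the eigenspace of $\lambda_2^N(\omega)$ with $\|\psi\|_{L^2(\omega)}=1$ (a normalized eigenfunction) put $$\mathbf X=\mathbf X(\omega,\psi):=\int_{\partial\omega}\mathbf n(\mathbf y)\,|\psi(\mathbf y)|^2\,\mathrm d\sigma(\mathbf y)\in\mathbb R^2,$$ where $\mathbf n$ is the unit outward normal, $\sigma$ is the one-dimensional Hausdorff measure, and the values of $\psi$ on $\partial\omega$ are those of its boundary trace. **Proposition 5.1.** 1. Let $\omega$ be the interior of any (nondegenerate) isosceles right triangle in $\mathbb R^2$.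 Then $\lambda_2^N(\omega)>0$ is a simple eigenvalue, and $\mathbf X(\omega,\psi)\neq 0$ for every normalized eigenfunction $\psi$ associated with $\lambda_2^N(\omega)$. 2. Let $\omega$ be the open triangle with vertices $(0,0)$, $(1,0)$, $(0,1)$. Then $\lambda_2^N(\omega)=\pi^2$, this eigenvalue is simple, the function $$\psi(y_1,y_2)=\sqrt2\,\bigl(\cos(\pi y_2)-\cos(\pi y_1)\bigr)$$ is a normalized eigenfunction associated with it, and $\mathbf X(\omega,\psi)=(1,1)$ for this and every other normalized eigenfunction $\psi$ associated with $\lambda_2^N(\omega)$. -/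

import Mathlib

open MeasureTheory Set Filter Topology

/-- The Euclidean plane `ℝ²`. -/
abbrev Plane : Type := EuclideanSpace ℝ (Fin 2)

/-- The complex Hilbert space `L²(ω)`. -/
abbrev L2 (ω : Set Plane) : Type := Lp ℂ 2 (volume.restrict ω)

/-- `g = ∂ᵢ u` weakly on `ω`: `∫_ω u ∂ᵢφ = - ∫_ω g φ` for all `φ ∈ C_c^∞(ω)`. -/
def HasWeakPartial (ω : Set Plane) (i : Fin 2) (u g : L2 ω) : Prop :=
  ∀ φ : Plane → ℝ, ContDiff ℝ (⊤ : ℕ∞) φ → HasCompactSupport φ → tsupport φ ⊆ ω →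
    ∫ y in ω, (fderiv ℝ φ y (EuclideanSpace.single i 1)) • u y = - ∫ y in ω, φ y • g y

/-- `G = ∇u` weakly on `ω`, with components in `L²(ω)`. Thus `u ∈ H¹(ω)` if and only if
`HasWeakGradient ω u G` for some `G`. -/
def HasWeakGradient (ω : Set Plane) (u : L2 ω) (G : Fin 2 → L2 ω) : Prop :=
  ∀ i, HasWeakPartial ω i u (G i)

lemma integrable_smul_L2 {ω : Set Plane} (f : Plane → ℝ) (hf : Continuous f)
    (hc : HasCompactSupport f) (u : L2 ω) :
    Integrable (fun y => f y • u y) (volume.restrict ω) := by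
  have h1 : MemLp f 2 (volume.restrict ω) := (hf.memLp_of_hasCompactSupport hc).restrict ω
  exact memLp_one_iff_integrable.mp (MemLp.smul (p := 2) (q := 2) (r := 1) (Lp.memLp u) h1)

lemma HasWeakPartial.add {ω : Set Plane} {i : Fin 2} {u g u' g' : L2 ω}
    (h : HasWeakPartial ω i u g) (h' : HasWeakPartial ω i u' g') :
    HasWeakPartial ω i (u + u') (g + g') := by
  intro φ hφ hc hs
  have hd : Continuous (fun y => fderiv ℝ φ y (EuclideanSpace.single i 1)) :=
    (hφ.continuous_fderiv (by simp)).clm_apply continuous_const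
  have hdc : HasCompactSupport (fun y => fderiv ℝ φ y (EuclideanSpace.single i 1)) :=
    hc.fderiv_apply ℝ _
  have e1 : ∫ y in ω, (fderiv ℝ φ y (EuclideanSpace.single i 1)) • (u + u') y
      = ∫ y in ω, ((fderiv ℝ φ y (EuclideanSpace.single i 1)) • u y
        + (fderiv ℝ φ y (EuclideanSpace.single i 1)) • u' y) := by
    refine integral_congr_ae ?_
    filter_upwards [Lp.coeFn_add u u'] with y hy
    rw [hy, Pi.add_apply, smul_add]
  have e2 : ∫ y in ω, φ y • (g + g') y = ∫ y in ω, (φ y • g y + φ y • g' y) := by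
    refine integral_congr_ae ?_
    filter_upwards [Lp.coeFn_add g g'] with y hy
    rw [hy, Pi.add_apply, smul_add]
  rw [e1, e2, integral_add (integrable_smul_L2 _ hd hdc u) (integrable_smul_L2 _ hd hdc u'),
    integral_add (integrable_smul_L2 _ hφ.continuous hc g)
      (integrable_smul_L2 _ hφ.continuous hc g'), h φ hφ hc hs, h' φ hφ hc hs]
  ring

lemma HasWeakPartial.smul {ω : Set Plane} {i : Fin 2} {u g : L2 ω} (c : ℂ)
    (h : HasWeakPartial ω i u g) : HasWeakPartial ω i (c • u) (c • g) := by
  intro φ hφ hc hs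
  have e1 : ∫ y in ω, (fderiv ℝ φ y (EuclideanSpace.single i 1)) • (c • u) y
      = ∫ y in ω, c • ((fderiv ℝ φ y (EuclideanSpace.single i 1)) • u y) := by
    refine integral_congr_ae ?_
    filter_upwards [Lp.coeFn_smul c u] with y hy
    rw [hy, Pi.smul_apply, smul_comm]
  have e2 : ∫ y in ω, φ y • (c • g) y = ∫ y in ω, c • (φ y • g y) := by
    refine integral_congr_ae ?_
    filter_upwards [Lp.coeFn_smul c g] with y hy
    rw [hy, Pi.smul_apply, smul_comm]
  rw [e1, e2, integral_smul, integral_smul, h φ hφ hc hs, smul_neg]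

lemma hasWeakGradient_zero (ω : Set Plane) : HasWeakGradient ω 0 0 := by
  intro i
  have e : ∀ f : Plane → ℝ, ∫ y in ω, f y • (0 : L2 ω) y = 0 := by
    intro f
    refine integral_eq_zero_of_ae ?_
    filter_upwards [Lp.coeFn_zero ℂ 2 (volume.restrict ω)] with y hy
    have hy' : (0 : L2 ω) y = 0 := hy
    rw [hy', smul_zero, Pi.zero_apply]
  intro φ _ _ _
  exact (e _).trans (neg_eq_zero.mpr (e φ)).symm

/-- The graph of the Neumann Laplacian `-Δ` in `L²(ω)`, whose domain is
`{u ∈ H¹(ω) : Δu ∈ L²(ω), ∂ₙu = 0}`. A pair `(u, w)` lies in it when `u ∈ H¹(ω)` and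
`∫_ω ∇u · conj (∇v) = ∫_ω w conj v` for all `v ∈ H¹(ω)`: for `v ∈ C_c^∞(ω)` this says
`-Δu = w` in the sense of distributions, and for general `v` it is Green's formula with
vanishing boundary term, the weak form of `∂ₙu = 0`. -/
noncomputable def neumannLaplacianGraph (ω : Set Plane) : Submodule ℂ (L2 ω × L2 ω) where
  carrier := {p | ∃ G : Fin 2 → L2 ω, HasWeakGradient ω p.1 G ∧
    ∀ (v : L2 ω) (H : Fin 2 → L2 ω), HasWeakGradient ω v H →
      ∑ i, inner ℂ (H i) (G i) = inner ℂ v p.2}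
  zero_mem' := ⟨0, hasWeakGradient_zero ω, fun v H _ => by simp⟩
  add_mem' := by
    rintro p q ⟨G, hG, h⟩ ⟨G', hG', h'⟩
    refine ⟨G + G', fun i => (hG i).add (hG' i), fun v H hv => ?_⟩
    simp only [Pi.add_apply, inner_add_right, Finset.sum_add_distrib, Prod.snd_add]
    rw [h v H hv, h' v H hv]
  smul_mem' := by
    rintro c p ⟨G, hG, h⟩
    refine ⟨c • G, fun i => (hG i).smul c, fun v H hv => ?_⟩
    simp only [Pi.smul_apply, inner_smul_right, ← Finset.mul_sum, Prod.smul_snd]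
    rw [h v H hv]

/-- The space of all `u` in the domain of the Neumann Laplacian `L` on `ω` with `L u = μ u`.
(`L` is self-adjoint, so only real `μ` matter.) -/
noncomputable def neumannEigenspace (ω : Set Plane) (μ : ℝ) : Submodule ℂ (L2 ω) :=
  (neumannLaplacianGraph ω).comap (LinearMap.prod LinearMap.id ((μ : ℂ) • LinearMap.id))

/-- `λₙᴺ(ω)`, `n ≥ 1`: the `n`-th eigenvalue of the Neumann Laplacian on `ω`, in nondecreasing
order and counted with multiplicity, i.e. the least `t` such that the eigenspaces with
eigenvalue at most `t` span a space of dimension at least `n`. -/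
noncomputable def neumannEigenvalue (ω : Set Plane) (n : ℕ) : ℝ :=
  sInf {t : ℝ | (n : Cardinal) ≤
    Module.rank ℂ (⨆ μ ∈ Iic t, neumannEigenspace ω μ : Submodule ℂ (L2 ω))}

/-- The boundary trace of `u` at `x ∈ ∂ω`, as the limit of the averages of `u` over
`B(x, r) ∩ ω` as `r → 0⁺`. For `u ∈ H¹(ω)` on a bounded Lipschitz domain the limit exists at
almost every boundary point and is the usual trace; if `u` has a continuous extension to the
closure of `ω`, it is the value of that extension. -/
noncomputable def boundaryTrace (ω : Set Plane) (u : L2 ω) (x : Plane) : ℂ :=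
  limUnder (𝓝[>] (0 : ℝ)) (fun r => ⨍ y in Metric.ball x r ∩ ω, u y)

/-- `ν` is the unit outward normal to `ω` at `x`: a unit vector such that, close to `x`, every
ray from `x` in a direction `v` with `v · ν < 0` runs in `ω`, and every ray in a direction
with `v · ν > 0` runs outside the closure of `ω`. -/
def IsOuterUnitNormal (ω : Set Plane) (x ν : Plane) : Prop :=
  ‖ν‖ = 1 ∧
  (∀ v : Plane, inner ℝ v ν < 0 → ∀ᶠ t in 𝓝[>] (0 : ℝ), x + t • v ∈ ω) ∧
  (∀ v : Plane, 0 < inner ℝ v ν → ∀ᶠ t in 𝓝[>] (0 : ℝ), x + t • v ∉ closure ω)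

/-- The unit outward normal is unique where it exists. -/
lemma IsOuterUnitNormal.unique {ω : Set Plane} {x ν ν' : Plane}
    (h : IsOuterUnitNormal ω x ν) (h' : IsOuterUnitNormal ω x ν') : ν = ν' := by
  by_contra hne
  have hlt : inner ℝ ν ν' < 1 := (inner_lt_one_iff_real_of_norm_eq_one h.1 h'.1).2 hne
  have a : inner ℝ (ν' - ν) ν < 0 := by
    rw [inner_sub_left, real_inner_self_eq_norm_sq, h.1, real_inner_comm]; linarith
  have b : 0 < inner ℝ (ν' - ν) ν' := by
    rw [inner_sub_left, real_inner_self_eq_norm_sq, h'.1]; linarith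
  obtain ⟨t, h1, h2⟩ := ((h.2.1 _ a).and (h'.2.2 _ b)).exists
  exact h2 (subset_closure h1)

open Classical in
/-- The unit outward normal field `n` on `∂ω` (with value `0` where there is no normal, as at
the corners of a polygon). -/
noncomputable def outerNormal (ω : Set Plane) (x : Plane) : Plane :=
  if h : ∃ ν, IsOuterUnitNormal ω x ν then h.choose else 0

/-- `X = ∫_{∂ω} n(y) |ψ(y)|² dσ(y)`, with `σ` the one-dimensional Hausdorff measure. -/
noncomputable def vectorX (ω : Set Plane) (ψ : L2 ω) : Plane :=
  ∫ y in frontier ω, (‖boundaryTrace ω ψ y‖ ^ 2) • outerNormal ω y ∂(Measure.hausdorffMeasure 1)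

/-- The open triangle with vertices `A`, `B`, `C`. -/
def openTriangle (A B C : Plane) : Set Plane :=
  interior (convexHull ℝ {A, B, C})

/-- `ω` is a nondegenerate open triangle with a right angle and two equal sides there. -/
def IsIsoscelesRightTriangle (ω : Set Plane) : Prop :=
  ∃ A B C : Plane, A ≠ B ∧ inner ℝ (B - A) (C - A) = 0 ∧ dist A B = dist A C ∧
    ω = openTriangle A B C

/-- The open triangle with vertices `(0,0)`, `(1,0)`, `(0,1)`. -/
def referenceTriangle : Set Plane :=
  openTriangle !₂[0, 0] !₂[1, 0] !₂[0, 1]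

/-! Reflection in the hypotenuse unfolds the triangle to a square of side `√q`, where the Neumann
problem is solved by products of cosines. In frame coordinates this reflection is `(X, Y) ↦ (1 - Y,
1 - X)`. Adding to `cos mπX cos nπY` its mirror image gives `mode m n`, a candidate eigenfunction
with eigenvalue `π² (m² + n²) / q`.

Two facts make these modes govern the whole spectrum. First, `sum_inner_gradModeL2` is Green's
formula for a mode against an arbitrary `v ∈ H¹`. It rests on `HasWeakGradient.integral_by_parts`,
which multiplies the smooth field by a cutoff near the boundary; the normal component of the field
vanishes linearly there, and this absorbs the growth of the cutoff's gradient. Hence modes are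
eigenfunctions, and they are orthogonal to every eigenspace with a different eigenvalue
(`inner_modeL2_eq_zero`). Second, the span of the modes is an algebra that separates the points of
the closed triangle, so by Stone–Weierstrass only `0` is orthogonal to all modes
(`eq_zero_of_inner_modeL2`). No regularity of an unknown eigenfunction is used.

An eigenvalue below `π² / q` can therefore only carry constants. At `π² / q` the contributing
indices are `(±1, 0)` and `(0, ±1)`, and all four modes equal `±(cos πX - cos πY)`. This gives
`eigenspace_gap` and `neumannEigenvalue_two`.

For the boundary vector, write `ψ = κ • modeL2 1 0`. Over `t ∈ [0, 1]`, the square of the mode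
integrates to `3/2` on each leg and to `2` on the hypotenuse. Weighting the outward directions `-b`,
`-c`, `b + c` by these numbers leaves `(|κ|² / 2) (b + c)`, which is nonzero. In the reference
triangle the mode has squared norm `1/2`, so normalization forces `|κ|² = 2` and the vector is `b +
c = (1, 1)`. -/

/-! ### Smooth cutoffs near a piecewise smooth boundary -/

/-- A smooth step function: `0` on `(-∞, 1]` and `1` on `[2, ∞)`. -/
noncomputable def smoothStep (s : ℝ) : ℝ := Real.smoothTransition (s - 1)

lemma smoothStep_of_le_one {s : ℝ} (h : s ≤ 1) : smoothStep s = 0 :=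
  Real.smoothTransition.zero_of_nonpos (by linarith)

lemma smoothStep_of_two_le {s : ℝ} (h : 2 ≤ s) : smoothStep s = 1 :=
  Real.smoothTransition.one_of_one_le (by linarith)

lemma abs_smoothStep_le_one (s : ℝ) : |smoothStep s| ≤ 1 := by
  unfold smoothStep
  rw [abs_of_nonneg (Real.smoothTransition.nonneg _)]
  exact Real.smoothTransition.le_one _

lemma contDiff_smoothStep : ContDiff ℝ (⊤ : ℕ∞) smoothStep :=
  Real.smoothTransition.contDiff.comp (contDiff_id.sub contDiff_const)

lemma deriv_smoothStep_of_lt_one {s : ℝ} (h : s < 1) : deriv smoothStep s = 0 := by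
  have : smoothStep =ᶠ[𝓝 s] fun _ => 0 := by
    filter_upwards [Iio_mem_nhds h] with t ht
    exact smoothStep_of_le_one (le_of_lt ht)
  rw [this.deriv_eq, deriv_const]

lemma deriv_smoothStep_of_two_lt {s : ℝ} (h : 2 < s) : deriv smoothStep s = 0 := by
  have : smoothStep =ᶠ[𝓝 s] fun _ => 1 := by
    filter_upwards [Ioi_mem_nhds h] with t ht
    exact smoothStep_of_two_le (le_of_lt ht)
  rw [this.deriv_eq, deriv_const]

/-- The derivative of `smoothStep (n * d)` grows like `n`, but only where `d` is of order `1 / n`.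
At `s = n * d` this bound is uniform in `n`. -/
lemma exists_bound_mul_deriv_smoothStep : ∃ M, ∀ s : ℝ, |s * deriv smoothStep s| ≤ M := by
  have hc : Continuous fun s : ℝ => s * deriv smoothStep s :=
    continuous_id.mul (contDiff_smoothStep.continuous_deriv (by simp))
  have hs : HasCompactSupport fun s : ℝ => s * deriv smoothStep s := by
    refine HasCompactSupport.intro (isCompact_Icc (a := (0 : ℝ)) (b := 3)) fun s hs => ?_
    rw [mem_Icc, not_and_or, not_le, not_le] at hs
    rcases hs with h | h
    · rw [deriv_smoothStep_of_lt_one (by linarith), mul_zero]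
    · rw [deriv_smoothStep_of_two_lt (by linarith), mul_zero]
  exact hs.exists_bound_of_continuous hc

section Cutoff

variable {ι : Type*} [Fintype ι]

/-- A smooth cutoff, vanishing where some `d j` is at most `1 / n`, and equal to `1` where every
`d j` is at least `2 / n`. -/
noncomputable def cutoff (d : ι → Plane → ℝ) (n : ℕ) (y : Plane) : ℝ :=
  ∏ j, smoothStep (n * d j y)

lemma contDiff_cutoff {d : ι → Plane → ℝ} (hd : ∀ j, ContDiff ℝ (⊤ : ℕ∞) (d j)) (n : ℕ) :
    ContDiff ℝ (⊤ : ℕ∞) (cutoff d n) :=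
  contDiff_prod fun j _ => contDiff_smoothStep.comp (contDiff_const.mul (hd j))

lemma abs_cutoff_le_one (d : ι → Plane → ℝ) (n : ℕ) (y : Plane) : |cutoff d n y| ≤ 1 := by
  unfold cutoff
  rw [Finset.abs_prod]
  exact Finset.prod_le_one (fun _ _ => abs_nonneg _) fun _ _ => abs_smoothStep_le_one _

lemma cutoff_eq_zero {d : ι → Plane → ℝ} {n : ℕ} {y : Plane} (h : ¬ ∀ j, 1 ≤ n * d j y) :
    cutoff d n y = 0 := by
  push Not at h
  obtain ⟨j, hj⟩ := h
  exact Finset.prod_eq_zero (Finset.mem_univ j) (smoothStep_of_le_one hj.le)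

lemma eventually_two_lt_mul {d : ι → Plane → ℝ} {y : Plane} (h : ∀ j, 0 < d j y) :
    ∀ᶠ n : ℕ in atTop, ∀ j, 2 < n * d j y := by
  rw [eventually_all]
  intro j
  exact ((tendsto_natCast_atTop_atTop (R := ℝ)).atTop_mul_const (h j)).eventually_gt_atTop 2

lemma tendsto_cutoff {d : ι → Plane → ℝ} {y : Plane} (h : ∀ j, 0 < d j y) :
    Tendsto (fun n => cutoff d n y) atTop (𝓝 1) := by
  refine tendsto_const_nhds.congr' ?_
  filter_upwards [eventually_two_lt_mul h] with n hn
  exact (Finset.prod_eq_one fun j _ => smoothStep_of_two_le (hn j).le).symm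

lemma fderiv_cutoff [DecidableEq ι] {d : ι → Plane → ℝ} (hd : ∀ j, ContDiff ℝ (⊤ : ℕ∞) (d j)) (n : ℕ)
    (y e : Plane) :
    fderiv ℝ (cutoff d n) y e = ∑ j, (∏ k ∈ Finset.univ.erase j, smoothStep (n * d k y)) *
      (deriv smoothStep (n * d j y) * (n * fderiv ℝ (d j) y e)) := by
  have h : ∀ j ∈ (Finset.univ : Finset ι), HasFDerivAt (fun y => smoothStep (n * d j y))
      (deriv smoothStep (n * d j y) • ((n : ℝ) • fderiv ℝ (d j) y)) y := by
    intro j _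
    have h1 : HasDerivAt smoothStep (deriv smoothStep (n * d j y)) (n * d j y) :=
      (contDiff_smoothStep.differentiable (by simp) _).hasDerivAt
    exact HasDerivAt.comp_hasFDerivAt (h₂ := smoothStep) y h1
      (((hd j).differentiable (by simp) y).hasFDerivAt.const_mul (n : ℝ))
  have := (HasFDerivAt.finsetProd h).fderiv
  unfold cutoff
  rw [this]
  simp

end Cutoff

/-! ### Integration by parts in `H¹` for fields tangent to the boundary -/

lemma integrable_coeFn_L2 {ω : Set Plane} (hb : Bornology.IsBounded ω) (u : L2 ω) :
    Integrable u (volume.restrict ω) := by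
  have : IsFiniteMeasure (volume.restrict ω) := ⟨by simpa using hb.measure_lt_top⟩
  exact (Lp.memLp u).integrable (by norm_num)

lemma exists_bound_of_isBounded {ω : Set Plane} (hb : Bornology.IsBounded ω) {f : Plane → ℝ}
    (hf : Continuous f) : ∃ C, ∀ y ∈ ω, |f y| ≤ C := by
  obtain ⟨C, hC⟩ := hb.isCompact_closure.exists_bound_of_continuousOn hf.continuousOn
  exact ⟨C, fun y hy => hC y (subset_closure hy)⟩

lemma tendsto_integral_mul_L2 {ω : Set Plane} (ho : MeasurableSet ω) (hb : Bornology.IsBounded ω)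
    (u : L2 ω)
    {f : ℕ → Plane → ℝ} {g : Plane → ℝ} (hf : ∀ n, Continuous (f n)) {C : ℝ}
    (hC : ∀ n, ∀ y ∈ ω, |f n y| ≤ C)
    (hl : ∀ y ∈ ω, Tendsto (fun n => f n y) atTop (𝓝 (g y))) :
    Tendsto (fun n => ∫ y in ω, f n y • u y) atTop (𝓝 (∫ y in ω, g y • u y)) := by
  refine tendsto_integral_of_dominated_convergence (fun y => C * ‖u y‖) (fun n => ?_)
    ((integrable_coeFn_L2 hb u).norm.const_mul C) (fun n => ?_) ?_
  · exact (hf n).aestronglyMeasurable.smul (Lp.aestronglyMeasurable u)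
  · filter_upwards [ae_restrict_mem ho] with y hy
    rw [norm_smul]
    exact mul_le_mul_of_nonneg_right (hC n y hy) (norm_nonneg _)
  · filter_upwards [ae_restrict_mem ho] with y hy
    exact (hl y hy).smul_const _

lemma integrable_continuous_smul_L2 {ω : Set Plane} (ho : MeasurableSet ω)
    (hb : Bornology.IsBounded ω) (u : L2 ω) {f : Plane → ℝ} (hf : Continuous f) :
    Integrable (fun y => f y • u y) (volume.restrict ω) := by
  obtain ⟨C, hC⟩ := exists_bound_of_isBounded hb hf
  refine ((integrable_coeFn_L2 hb u).norm.const_mul C).mono'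
    (hf.aestronglyMeasurable.smul (Lp.aestronglyMeasurable u)) ?_
  filter_upwards [ae_restrict_mem ho] with y hy
  rw [norm_smul]
  exact mul_le_mul_of_nonneg_right (hC y hy) (norm_nonneg _)

/-- Integration by parts for `v ∈ H¹(ω)` against a smooth vector field `F` whose component normal
to the piecewise smooth boundary of `ω = {d j > 0}` vanishes. -/
theorem HasWeakGradient.integral_by_parts {ι : Type*} [Fintype ι] [DecidableEq ι] {ω : Set Plane}
    {d : ι → Plane → ℝ} (hd : ∀ j, ContDiff ℝ (⊤ : ℕ∞) (d j)) (hω : ω = {y | ∀ j, 0 < d j y})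
    (hb : Bornology.IsBounded ω) {F : Fin 2 → Plane → ℝ} (hF : ∀ i, ContDiff ℝ (⊤ : ℕ∞) (F i))
    {C : ℝ} (hC : ∀ j, ∀ y ∈ ω,
      |∑ i, F i y * fderiv ℝ (d j) y (EuclideanSpace.single i 1)| ≤ C * d j y)
    {v : L2 ω} {H : Fin 2 → L2 ω} (h : HasWeakGradient ω v H) :
    ∑ i, ∫ y in ω, F i y • H i y =
      - ∫ y in ω, (∑ i, fderiv ℝ (F i) y (EuclideanSpace.single i 1)) • v y := by
  have ho : MeasurableSet ω := by
    have : IsOpen ω := by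
      rw [hω, ← iInter_ofPred]
      exact isOpen_iInter_of_finite fun j => isOpen_lt continuous_const (hd j).continuous
    exact this.measurableSet
  have hpos : ∀ y ∈ ω, ∀ j, 0 < d j y := fun y hy => by rw [hω] at hy; exact hy
  set e : Fin 2 → Plane := fun i => EuclideanSpace.single i 1 with he
  have hsmooth : ∀ n i, ContDiff ℝ (⊤ : ℕ∞) (fun y => cutoff d n y * F i y) := fun n i =>
    (contDiff_cutoff hd n).mul (hF i)
  have hder : ∀ n i y, fderiv ℝ (fun y => cutoff d n y * F i y) y (e i) =
      cutoff d n y * fderiv ℝ (F i) y (e i) + F i y * fderiv ℝ (cutoff d n) y (e i) := by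
    intro n i y
    have := (((contDiff_cutoff hd n).differentiable (by simp) y).hasFDerivAt.mul
      ((hF i).differentiable (by simp) y).hasFDerivAt).fderiv
    have h2 : fderiv ℝ (fun y => cutoff d n y * F i y) y = _ := this
    rw [h2]
    simp
  have hcF : ∀ i, Continuous fun y => fderiv ℝ (F i) y (e i) := fun i =>
    ((hF i).continuous_fderiv (by simp)).clm_apply continuous_const
  have hcχ : ∀ n i, Continuous fun y => fderiv ℝ (cutoff d n) y (e i) := fun n i =>
    ((contDiff_cutoff hd n).continuous_fderiv (by simp)).clm_apply continuous_const
  have hcF' : Continuous fun y => ∑ i, fderiv ℝ (F i) y (e i) :=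
    continuous_finsetSum _ fun i _ => hcF i
  -- the identity for the truncated field
  have key : ∀ n : ℕ, ∫ y in ω, (cutoff d n y * (∑ i, fderiv ℝ (F i) y (e i)) +
        ∑ i, F i y * fderiv ℝ (cutoff d n) y (e i)) • v y =
      - ∑ i, ∫ y in ω, (cutoff d n y * F i y) • H i y := by
    intro n
    -- A set on which every `n * d j` is at least `1` keeps away from the boundary, so the truncated
    -- field has compact support in `ω` and is an admissible test function.
    have hcomp : ∃ K : Set Plane, IsCompact K ∧ IsClosed K ∧ K ⊆ ω ∧
        ∀ y ∉ K, cutoff d n y = 0 := by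
      have hcl : IsClosed {y | ∀ j, 1 ≤ n * d j y} := by
        rw [← iInter_ofPred]
        exact isClosed_iInter fun j =>
          isClosed_le continuous_const (continuous_const.mul (hd j).continuous)
      have hsub : {y | ∀ j, 1 ≤ n * d j y} ⊆ ω := by
        intro y hy
        rw [hω]
        intro j
        have := hy j
        by_contra hcon
        have : (n : ℝ) * d j y ≤ 0 :=
          mul_nonpos_of_nonneg_of_nonpos (Nat.cast_nonneg n) (not_lt.1 hcon)
        linarith
      exact ⟨_, Metric.isCompact_of_isClosed_isBounded hcl (hb.subset hsub), hcl, hsub,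
        fun y hy => cutoff_eq_zero hy⟩
    obtain ⟨K, hK, hKc, hKω, hK0⟩ := hcomp
    have hi : ∀ i, ∫ y in ω, (fderiv ℝ (fun y => cutoff d n y * F i y) y (e i)) • v y =
        - ∫ y in ω, (cutoff d n y * F i y) • H i y := by
      intro i
      refine h i _ (hsmooth n i) (HasCompactSupport.intro hK fun y hy => by simp [hK0 y hy]) ?_
      refine (closure_minimal ?_ hKc).trans hKω
      intro y hy
      by_contra hyK
      exact hy (by simp [hK0 y hyK])
    rw [← Finset.sum_neg_distrib, ← Finset.sum_congr rfl fun i _ => hi i, ← integral_finsetSum]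
    · refine integral_congr_ae (Eventually.of_forall fun y => ?_)
      simp only [hder]
      rw [← Finset.sum_smul, Finset.sum_add_distrib, Finset.mul_sum]
    · intro i _
      refine integrable_continuous_smul_L2 ho hb v ?_
      exact ((hsmooth n i).continuous_fderiv (by simp)).clm_apply continuous_const
  obtain ⟨M, hM⟩ := exists_bound_mul_deriv_smoothStep
  have hM0 : 0 ≤ M := (abs_nonneg _).trans (hM 0)
  have hterm : ∀ n y, ∑ i, F i y * fderiv ℝ (cutoff d n) y (e i) =
      ∑ j, (∏ k ∈ Finset.univ.erase j, smoothStep (n * d k y)) *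
        (deriv smoothStep (n * d j y) * (n * ∑ i, F i y * fderiv ℝ (d j) y (e i))) := by
    intro n y
    simp only [fderiv_cutoff hd, Finset.mul_sum]
    rw [Finset.sum_comm]
    refine Finset.sum_congr rfl fun j _ => Finset.sum_congr rfl fun i _ => ?_
    ring
  -- The heart of the argument: differentiating the cutoff costs a factor `n`, the hypothesis `hC`
  -- returns a factor `d j`, and `n * d j` times the derivative of the step is bounded by `M` for
  -- all `n`.
  have hbound : ∀ n, ∀ y ∈ ω, |∑ i, F i y * fderiv ℝ (cutoff d n) y (e i)| ≤
      ∑ _j : ι, |C| * M := by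
    intro n y hy
    rw [hterm]
    refine (Finset.abs_sum_le_sum_abs _ _).trans (Finset.sum_le_sum fun j _ => ?_)
    rw [abs_mul]
    have h1 : |∏ k ∈ Finset.univ.erase j, smoothStep (n * d k y)| ≤ 1 := by
      rw [Finset.abs_prod]
      exact Finset.prod_le_one (fun _ _ => abs_nonneg _) fun _ _ => abs_smoothStep_le_one _
    have hdj := hpos y hy j
    have h2 : |deriv smoothStep (n * d j y) * (n * ∑ i, F i y * fderiv ℝ (d j) y (e i))| ≤
        |C| * M := by
      rw [abs_mul, abs_mul]
      have h3 := hM (n * d j y)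
      rw [abs_mul, abs_mul, abs_of_pos hdj] at h3
      have h4 : |∑ i, F i y * fderiv ℝ (d j) y (e i)| ≤ |C| * d j y :=
        (hC j y hy).trans (mul_le_mul_of_nonneg_right (le_abs_self C) hdj.le)
      calc _ ≤ |deriv smoothStep (n * d j y)| * (|(n : ℝ)| * (|C| * d j y)) := by gcongr
        _ = |C| * (|(n : ℝ)| * d j y * |deriv smoothStep (n * d j y)|) := by ring
        _ ≤ _ := by gcongr
    calc _ ≤ 1 * (|C| * M) := mul_le_mul h1 h2 (abs_nonneg _) zero_le_one
      _ = _ := one_mul _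
  obtain ⟨D, hD⟩ := exists_bound_of_isBounded hb hcF'
  have lim1 : Tendsto (fun n : ℕ => ∫ y in ω, (cutoff d n y * (∑ i, fderiv ℝ (F i) y (e i)) +
        ∑ i, F i y * fderiv ℝ (cutoff d n) y (e i)) • v y) atTop
      (𝓝 (∫ y in ω, (∑ i, fderiv ℝ (F i) y (e i)) • v y)) := by
    refine tendsto_integral_mul_L2 ho hb v (C := D + ∑ _j : ι, |C| * M) (fun n => ?_) ?_ ?_
    · exact ((contDiff_cutoff hd n).continuous.mul hcF').add
        (continuous_finsetSum _ fun i _ => (hF i).continuous.mul (hcχ n i))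
    · intro n y hy
      refine (abs_add_le _ _).trans (add_le_add ?_ (hbound n y hy))
      rw [abs_mul]
      calc _ ≤ 1 * D := mul_le_mul (abs_cutoff_le_one d n y) (hD y hy) (abs_nonneg _) zero_le_one
        _ = D := one_mul _
    · intro y hy
      have t1 := (tendsto_cutoff (hpos y hy)).mul_const (∑ i, fderiv ℝ (F i) y (e i))
      -- At a fixed interior point the cutoff is locally constant as soon as every `n * d j` exceeds
      -- `2`.
      have t2 : Tendsto (fun n : ℕ => ∑ i, F i y * fderiv ℝ (cutoff d n) y (e i)) atTop (𝓝 0) := by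
        refine tendsto_const_nhds.congr' ?_
        filter_upwards [eventually_two_lt_mul (hpos y hy)] with n hn
        rw [hterm]
        refine (Finset.sum_eq_zero fun j _ => ?_).symm
        rw [deriv_smoothStep_of_two_lt (hn j)]
        ring
      simpa using t1.add t2
  have lim2 : Tendsto (fun n : ℕ => - ∑ i, ∫ y in ω, (cutoff d n y * F i y) • H i y) atTop
      (𝓝 (- ∑ i, ∫ y in ω, F i y • H i y)) := by
    refine (tendsto_finsetSum _ fun i _ => ?_).neg
    obtain ⟨D', hD'⟩ := exists_bound_of_isBounded hb (hF i).continuous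
    refine tendsto_integral_mul_L2 ho hb (H i) (C := D') (fun n => (hsmooth n i).continuous) ?_ ?_
    · intro n y hy
      rw [abs_mul]
      calc _ ≤ 1 * D' := mul_le_mul (abs_cutoff_le_one d n y) (hD' y hy) (abs_nonneg _) zero_le_one
        _ = D' := one_mul _
    · intro y hy
      simpa using (tendsto_cutoff (hpos y hy)).mul_const (F i y)
  have := tendsto_nhds_unique (lim1.congr key) lim2
  rw [this, neg_neg]

/-! ### Continuous functions as elements of `L²` and `H¹` -/

/-- The class in `L²(ω)` of a real continuous function, for bounded `ω`. -/
noncomputable def continuousToL2 {ω : Set Plane} (ho : MeasurableSet ω)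
    (hb : Bornology.IsBounded ω) (f : Plane → ℝ) (hf : Continuous f) : L2 ω :=
  MemLp.toLp (fun y => (f y : ℂ)) <| by
    have : IsFiniteMeasure (volume.restrict ω) := ⟨by simpa using hb.measure_lt_top⟩
    refine MemLp.of_bound (Complex.continuous_ofReal.comp hf).aestronglyMeasurable
      (exists_bound_of_isBounded hb hf).choose ?_
    filter_upwards [ae_restrict_mem ho] with y hy
    simpa using (exists_bound_of_isBounded hb hf).choose_spec y hy

section ContinuousToL2

variable {ω : Set Plane} (ho : MeasurableSet ω) (hb : Bornology.IsBounded ω)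

lemma coeFn_continuousToL2 {f : Plane → ℝ} (hf : Continuous f) :
    ∀ᵐ y ∂(volume.restrict ω), continuousToL2 ho hb f hf y = (f y : ℂ) :=
  MemLp.coeFn_toLp _

lemma inner_continuousToL2_left {f : Plane → ℝ} (hf : Continuous f) (u : L2 ω) :
    inner ℂ (continuousToL2 ho hb f hf) u = ∫ y in ω, f y • u y := by
  rw [L2.inner_def]
  refine integral_congr_ae ?_
  filter_upwards [coeFn_continuousToL2 ho hb hf] with y hy
  rw [hy]
  simp [mul_comm]

/-- Since the test function is supported in `ω` and `f` is smooth on the whole plane, both integrals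
extend to the plane, where classical integration by parts has no boundary term. -/
lemma hasWeakGradient_continuousToL2 {f : Plane → ℝ} (hf : ContDiff ℝ (⊤ : ℕ∞) f)
    {g : Fin 2 → Plane → ℝ} (hg : ∀ i, Continuous (g i))
    (hfg : ∀ i y, fderiv ℝ f y (EuclideanSpace.single i 1) = g i y) :
    HasWeakGradient ω (continuousToL2 ho hb f hf.continuous)
      (fun i => continuousToL2 ho hb (g i) (hg i)) := by
  intro i φ hφ hc hs
  have e1 : ∫ y in ω, (fderiv ℝ φ y (EuclideanSpace.single i 1)) •
      continuousToL2 ho hb f hf.continuous y =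
      ((∫ y, fderiv ℝ φ y (EuclideanSpace.single i 1) * f y : ℝ) : ℂ) := by
    rw [← integral_complex_ofReal]
    refine Eq.trans ?_ (setIntegral_eq_integral_of_forall_compl_eq_zero (s := ω) ?_)
    · refine integral_congr_ae ?_
      filter_upwards [coeFn_continuousToL2 ho hb hf.continuous] with y hy
      rw [hy]
      simp
    · intro y hy
      have : fderiv ℝ φ y = 0 := by
        by_contra hne
        exact hy (hs (support_fderiv_subset ℝ hne))
      simp [this]
  have e2 : ∫ y in ω, φ y • continuousToL2 ho hb (g i) (hg i) y =
      ((∫ y, φ y * fderiv ℝ f y (EuclideanSpace.single i 1) : ℝ) : ℂ) := by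
    rw [← integral_complex_ofReal]
    refine Eq.trans ?_ (setIntegral_eq_integral_of_forall_compl_eq_zero (s := ω) ?_)
    · refine integral_congr_ae ?_
      filter_upwards [coeFn_continuousToL2 ho hb (hg i)] with y hy
      rw [hy, hfg]
      simp
    · intro y hy
      have : φ y = 0 := by
        by_contra hne
        exact hy (hs (subset_tsupport φ hne))
      simp [this]
  have hdφ : Continuous fun y => fderiv ℝ φ y (EuclideanSpace.single i 1) :=
    (hφ.continuous_fderiv (by simp)).clm_apply continuous_const
  have hdf : Continuous fun y => fderiv ℝ f y (EuclideanSpace.single i 1) :=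
    (hf.continuous_fderiv (by simp)).clm_apply continuous_const
  rw [e1, e2, ← Complex.ofReal_neg, integral_mul_fderiv_eq_neg_fderiv_mul_of_integrable, neg_neg]
  · exact (hdφ.mul hf.continuous).integrable_of_hasCompactSupport
      ((hc.fderiv_apply ℝ _).mul_right)
  · exact (hφ.continuous.mul hdf).integrable_of_hasCompactSupport hc.mul_right
  · exact (hφ.continuous.mul hf.continuous).integrable_of_hasCompactSupport hc.mul_right
  · exact fun y _ => hφ.differentiable (by simp) y
  · exact fun y _ => hf.differentiable (by simp) y

end ContinuousToL2

lemma mem_neumannEigenspace {ω : Set Plane} {μ : ℝ} {u : L2 ω} :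
    u ∈ neumannEigenspace ω μ ↔ ∃ G : Fin 2 → L2 ω, HasWeakGradient ω u G ∧
      ∀ (v : L2 ω) (H : Fin 2 → L2 ω), HasWeakGradient ω v H →
        ∑ i, inner ℂ (H i) (G i) = (μ : ℂ) * inner ℂ v u := by
  simp only [← inner_smul_right]
  rfl

/-! ### Orthogonal coordinates adapted to the triangle -/

/-- An isosceles right triangle in coordinates: the right angle is at `A`, and the legs are `b`
and `c`, of length `√q`. -/
structure IsoFrame where
  A : Plane
  b : Plane
  c : Plane
  q : ℝ
  q_pos : 0 < q
  ortho : b 0 * c 0 + b 1 * c 1 = 0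
  sq_b : b 0 ^ 2 + b 1 ^ 2 = q
  sq_c : c 0 ^ 2 + c 1 ^ 2 = q

namespace IsoFrame

variable (T : IsoFrame)

lemma q_ne : T.q ≠ 0 := T.q_pos.ne'

/-- The matrix with rows `b`, `c` is `√q` times an orthogonal one, so its columns satisfy the same
relations as its rows. This and the next three lemmas derive that by polynomial identities. -/
lemma sq_c_zero : T.c 0 ^ 2 = T.b 1 ^ 2 := by
  have h : T.q * (T.c 0 ^ 2 - T.b 1 ^ 2) = 0 := by
    linear_combination (T.b 0 * T.c 0 - T.b 1 * T.c 1) * T.ortho - T.c 0 ^ 2 * T.sq_b +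
      T.b 1 ^ 2 * T.sq_c
  have := (mul_eq_zero.1 h).resolve_left T.q_ne
  linarith

lemma col_zero : T.b 0 ^ 2 + T.c 0 ^ 2 = T.q := by
  rw [T.sq_c_zero, T.sq_b]

lemma col_one : T.b 1 ^ 2 + T.c 1 ^ 2 = T.q := by
  rw [← T.sq_c_zero, T.sq_c]

lemma col_ortho : T.b 0 * T.b 1 + T.c 0 * T.c 1 = 0 := by
  have h1 := T.sq_c_zero
  have h2 : T.c 1 ^ 2 = T.b 0 ^ 2 := by linarith [T.sq_b, T.sq_c]
  have h := T.ortho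
  -- Only the squares of the entries of `c` are known in terms of `b`, so the vanishing is proved
  -- for the square.
  have : (T.b 0 * T.b 1 + T.c 0 * T.c 1) ^ 2 = 0 := by
    linear_combination (2 * T.b 0 * T.c 0) * h + (T.c 1 ^ 2 - 2 * T.b 0 ^ 2) * h1 + T.b 1 ^ 2 * h2
  exact pow_eq_zero_iff (two_ne_zero) |>.1 this

/-- The differential of the first coordinate. -/
noncomputable def dX : Plane →L[ℝ] ℝ := T.q⁻¹ • innerSL ℝ T.b

/-- The differential of the second coordinate. -/
noncomputable def dY : Plane →L[ℝ] ℝ := T.q⁻¹ • innerSL ℝ T.c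

/-- The first coordinate along the frame. -/
noncomputable def X (y : Plane) : ℝ := T.dX (y - T.A)

/-- The second coordinate along the frame. -/
noncomputable def Y (y : Plane) : ℝ := T.dY (y - T.A)

lemma dX_apply (v : Plane) : T.dX v = (T.b 0 * v 0 + T.b 1 * v 1) / T.q := by
  simp [dX, PiLp.inner_apply, Fin.sum_univ_two]
  field_simp

lemma dY_apply (v : Plane) : T.dY v = (T.c 0 * v 0 + T.c 1 * v 1) / T.q := by
  simp [dY, PiLp.inner_apply, Fin.sum_univ_two]
  field_simp

lemma dX_b : T.dX T.b = 1 := by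
  rw [dX_apply, div_eq_one_iff_eq T.q_ne, ← T.sq_b]; ring

lemma dX_c : T.dX T.c = 0 := by
  rw [dX_apply, T.ortho, zero_div]

lemma dY_b : T.dY T.b = 0 := by
  rw [dY_apply, mul_comm, mul_comm (T.c 1), T.ortho, zero_div]

lemma dY_c : T.dY T.c = 1 := by
  rw [dY_apply, div_eq_one_iff_eq T.q_ne, ← T.sq_c]; ring

lemma decompose (v : Plane) : v = T.dX v • T.b + T.dY v • T.c := by
  have hq := T.q_ne
  have h0 := T.col_zero
  have h1 := T.col_one
  have h2 := T.col_ortho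
  ext i
  fin_cases i
  · simp only [dX_apply, dY_apply, Fin.zero_eta, PiLp.add_apply, PiLp.smul_apply, smul_eq_mul]
    field_simp
    linear_combination (-v 0) * h0 - v 1 * h2
  · simp only [dX_apply, dY_apply, Fin.mk_one, PiLp.add_apply, PiLp.smul_apply, smul_eq_mul]
    field_simp
    linear_combination (-v 1) * h1 - v 0 * h2

lemma eq_point (y : Plane) : y = T.A + (T.X y • T.b + T.Y y • T.c) := by
  rw [X, Y, ← T.decompose]; abel

lemma X_point (s t : ℝ) : T.X (T.A + (s • T.b + t • T.c)) = s := by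
  simp [X, dX_b, dX_c]

lemma Y_point (s t : ℝ) : T.Y (T.A + (s • T.b + t • T.c)) = t := by
  simp [Y, dY_b, dY_c]

lemma hasFDerivAt_X (y : Plane) : HasFDerivAt T.X T.dX y := by
  exact T.dX.hasFDerivAt.comp y ((hasFDerivAt_id y).sub_const T.A)

lemma hasFDerivAt_Y (y : Plane) : HasFDerivAt T.Y T.dY y := by
  exact T.dY.hasFDerivAt.comp y ((hasFDerivAt_id y).sub_const T.A)

@[fun_prop]
lemma contDiff_X {n} : ContDiff ℝ n T.X := T.dX.contDiff.comp (contDiff_id.sub contDiff_const)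

@[fun_prop]
lemma contDiff_Y {n} : ContDiff ℝ n T.Y := T.dY.contDiff.comp (contDiff_id.sub contDiff_const)

@[fun_prop]
lemma continuous_X : Continuous T.X := (T.contDiff_X (n := 0)).continuous

@[fun_prop]
lemma continuous_Y : Continuous T.Y := (T.contDiff_Y (n := 0)).continuous

/-- The functions that are positive exactly on the inner side of the three edges. -/
noncomputable def side : Fin 3 → Plane → ℝ := ![T.X, T.Y, fun y => 1 - T.X y - T.Y y]

/-- The open triangle of the frame. -/
def domain : Set Plane := {y | ∀ j, 0 < T.side j y}

lemma contDiff_side {n} (j : Fin 3) : ContDiff ℝ n (T.side j) := by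
  fin_cases j
  · exact T.contDiff_X
  · exact T.contDiff_Y
  · exact (contDiff_const.sub T.contDiff_X).sub T.contDiff_Y

lemma continuous_side (j : Fin 3) : Continuous (T.side j) :=
  (T.contDiff_side (n := 0) j).continuous

lemma mem_domain {y : Plane} :
    y ∈ T.domain ↔ 0 < T.X y ∧ 0 < T.Y y ∧ T.X y + T.Y y < 1 := by
  simp only [domain, side, mem_ofPred_eq, Fin.forall_fin_succ, IsEmpty.forall_iff, and_true,
    Matrix.cons_val_zero, Matrix.cons_val_succ]
  constructor <;> rintro ⟨h1, h2, h3⟩ <;> exact ⟨h1, h2, by linarith⟩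

lemma isOpen_domain : IsOpen T.domain := by
  rw [domain, ← iInter_ofPred]
  exact isOpen_iInter_of_finite fun j => isOpen_lt continuous_const (T.continuous_side j)

/-- The closed triangle of the frame. -/
def closedDomain : Set Plane := {y | ∀ j, 0 ≤ T.side j y}

lemma mem_closedDomain {y : Plane} :
    y ∈ T.closedDomain ↔ 0 ≤ T.X y ∧ 0 ≤ T.Y y ∧ T.X y + T.Y y ≤ 1 := by
  simp only [closedDomain, side, mem_ofPred_eq, Fin.forall_fin_succ, IsEmpty.forall_iff, and_true,
    Matrix.cons_val_zero, Matrix.cons_val_succ]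
  constructor <;> rintro ⟨h1, h2, h3⟩ <;> exact ⟨h1, h2, by linarith⟩

lemma isClosed_closedDomain : IsClosed T.closedDomain := by
  rw [closedDomain, ← iInter_ofPred]
  exact isClosed_iInter fun j => isClosed_le continuous_const (T.continuous_side j)

lemma domain_subset : T.domain ⊆ T.closedDomain := fun _ hy j => (hy j).le

lemma isCompact_closedDomain : IsCompact T.closedDomain := by
  have h : T.closedDomain ⊆ (fun p : ℝ × ℝ => T.A + (p.1 • T.b + p.2 • T.c)) ''
      (Icc 0 1 ×ˢ Icc 0 1) := by
    intro y hy
    obtain ⟨h1, h2, h3⟩ := T.mem_closedDomain.1 hy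
    exact ⟨(T.X y, T.Y y), ⟨⟨h1, by simp only; linarith⟩, h2, by simp only; linarith⟩,
      (T.eq_point y).symm⟩
  exact ((isCompact_Icc.prod isCompact_Icc).image (by fun_prop)).of_isClosed_subset
    T.isClosed_closedDomain h

lemma isBounded_domain : Bornology.IsBounded T.domain :=
  T.isCompact_closedDomain.isBounded.subset T.domain_subset

lemma measurableSet_domain : MeasurableSet T.domain := T.isOpen_domain.measurableSet

/-- The class of a continuous function in `L²` of the triangle. -/
noncomputable abbrev toL2 (f : Plane → ℝ) (hf : Continuous f) : L2 T.domain :=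
  continuousToL2 T.measurableSet_domain T.isBounded_domain f hf

/-! ### The modes: derivatives, Laplacian and normal derivative -/

/-- The Neumann eigenfunctions of the triangle: the symmetrization of `cos mπX cos nπY` under
reflection in the hypotenuse. -/
noncomputable def mode (m n : ℤ) (y : Plane) : ℝ :=
  Real.cos (m * Real.pi * T.X y) * Real.cos (n * Real.pi * T.Y y) +
    Real.cos (m * Real.pi * (1 - T.Y y)) * Real.cos (n * Real.pi * (1 - T.X y))

/-- The derivative of `mode` in the first coordinate. -/
noncomputable def modeX (m n : ℤ) (y : Plane) : ℝ :=
  -(m * Real.pi) * (Real.sin (m * Real.pi * T.X y) * Real.cos (n * Real.pi * T.Y y)) +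
    (n * Real.pi) *
      (Real.cos (m * Real.pi * (1 - T.Y y)) * Real.sin (n * Real.pi * (1 - T.X y)))

/-- The derivative of `mode` in the second coordinate. -/
noncomputable def modeY (m n : ℤ) (y : Plane) : ℝ :=
  -(n * Real.pi) * (Real.cos (m * Real.pi * T.X y) * Real.sin (n * Real.pi * T.Y y)) +
    (m * Real.pi) *
      (Real.sin (m * Real.pi * (1 - T.Y y)) * Real.cos (n * Real.pi * (1 - T.X y)))

lemma contDiff_mode (m n : ℤ) {k} : ContDiff ℝ k (T.mode m n) := by
  unfold mode; fun_prop

lemma contDiff_modeX (m n : ℤ) {k} : ContDiff ℝ k (T.modeX m n) := by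
  unfold modeX; fun_prop

lemma contDiff_modeY (m n : ℤ) {k} : ContDiff ℝ k (T.modeY m n) := by
  unfold modeY; fun_prop

lemma continuous_mode (m n : ℤ) : Continuous (T.mode m n) :=
  (T.contDiff_mode m n (k := 0)).continuous

lemma hasFDerivAt_mode (m n : ℤ) (y : Plane) :
    HasFDerivAt (T.mode m n) (T.modeX m n y • T.dX + T.modeY m n y • T.dY) y := by
  have hX := T.hasFDerivAt_X y
  have hY := T.hasFDerivAt_Y y
  have h := ((hX.const_mul (m * Real.pi)).cos.mul (hY.const_mul (n * Real.pi)).cos).add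
    (((hY.const_sub 1).const_mul (m * Real.pi)).cos.mul
      ((hX.const_sub 1).const_mul (n * Real.pi)).cos)
  refine h.congr_fderiv ?_
  ext v
  simp [modeX, modeY]
  ring

lemma hasFDerivAt_modeX (m n : ℤ) (y : Plane) :
    HasFDerivAt (T.modeX m n)
      ((-(m * Real.pi) ^ 2 * (Real.cos (m * Real.pi * T.X y) * Real.cos (n * Real.pi * T.Y y)) -
        (n * Real.pi) ^ 2 * (Real.cos (m * Real.pi * (1 - T.Y y)) *
          Real.cos (n * Real.pi * (1 - T.X y)))) • T.dX +
      (m * Real.pi * (n * Real.pi) *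
        (Real.sin (m * Real.pi * T.X y) * Real.sin (n * Real.pi * T.Y y) +
        Real.sin (m * Real.pi * (1 - T.Y y)) * Real.sin (n * Real.pi * (1 - T.X y)))) • T.dY) y := by
  have hX := T.hasFDerivAt_X y
  have hY := T.hasFDerivAt_Y y
  have h := (((hX.const_mul (m * Real.pi)).sin.mul
    (hY.const_mul (n * Real.pi)).cos).const_mul (-(m * Real.pi))).add
    ((((hY.const_sub 1).const_mul (m * Real.pi)).cos.mul
      ((hX.const_sub 1).const_mul (n * Real.pi)).sin).const_mul (n * Real.pi))
  refine h.congr_fderiv ?_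
  ext v
  simp
  ring

lemma hasFDerivAt_modeY (m n : ℤ) (y : Plane) :
    HasFDerivAt (T.modeY m n)
      ((m * Real.pi * (n * Real.pi) *
        (Real.sin (m * Real.pi * T.X y) * Real.sin (n * Real.pi * T.Y y) +
        Real.sin (m * Real.pi * (1 - T.Y y)) * Real.sin (n * Real.pi * (1 - T.X y)))) • T.dX +
      (-(n * Real.pi) ^ 2 * (Real.cos (m * Real.pi * T.X y) * Real.cos (n * Real.pi * T.Y y)) -
        (m * Real.pi) ^ 2 * (Real.cos (m * Real.pi * (1 - T.Y y)) *
          Real.cos (n * Real.pi * (1 - T.X y)))) • T.dY) y := by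
  have hX := T.hasFDerivAt_X y
  have hY := T.hasFDerivAt_Y y
  have h := (((hX.const_mul (m * Real.pi)).cos.mul
    (hY.const_mul (n * Real.pi)).sin).const_mul (-(n * Real.pi))).add
    ((((hY.const_sub 1).const_mul (m * Real.pi)).sin.mul
      ((hX.const_sub 1).const_mul (n * Real.pi)).cos).const_mul (m * Real.pi))
  refine h.congr_fderiv ?_
  ext v
  simp
  ring

/-- The components of the gradient of `mode`. -/
noncomputable def gradMode (m n : ℤ) (i : Fin 2) (y : Plane) : ℝ :=
  T.modeX m n y * (T.b i / T.q) + T.modeY m n y * (T.c i / T.q)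

lemma contDiff_gradMode (m n : ℤ) (i : Fin 2) {k} : ContDiff ℝ k (T.gradMode m n i) :=
  ((T.contDiff_modeX m n).mul contDiff_const).add ((T.contDiff_modeY m n).mul contDiff_const)

lemma continuous_gradMode (m n : ℤ) (i : Fin 2) : Continuous (T.gradMode m n i) :=
  (T.contDiff_gradMode m n i (k := 0)).continuous

lemma dX_single (i : Fin 2) : T.dX (EuclideanSpace.single i 1) = T.b i / T.q := by
  fin_cases i <;> simp [dX_apply]

lemma dY_single (i : Fin 2) : T.dY (EuclideanSpace.single i 1) = T.c i / T.q := by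
  fin_cases i <;> simp [dY_apply]

lemma fderiv_mode (m n : ℤ) (i : Fin 2) (y : Plane) :
    fderiv ℝ (T.mode m n) y (EuclideanSpace.single i 1) = T.gradMode m n i y := by
  rw [(T.hasFDerivAt_mode m n y).fderiv]
  simp [gradMode, dX_single, dY_single]

/-- The eigenvalue of `mode m n`. -/
noncomputable def modeEigenvalue (m n : ℤ) : ℝ := Real.pi ^ 2 * (m ^ 2 + n ^ 2) / T.q

/-- In this frame the Laplacian is `(∂_X² + ∂_Y²) / q`. The mixed derivative, abbreviated `k3`,
occurs only with the factor `b · c = 0`. -/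
lemma div_gradMode (m n : ℤ) (y : Plane) :
    ∑ i, fderiv ℝ (T.gradMode m n i) y (EuclideanSpace.single i 1) =
      -(T.modeEigenvalue m n * T.mode m n y) := by
  have h : ∀ i, HasFDerivAt (T.gradMode m n i) _ y := fun i =>
    ((T.hasFDerivAt_modeX m n y).mul_const (T.b i / T.q)).add
      ((T.hasFDerivAt_modeY m n y).mul_const (T.c i / T.q))
  simp only [(h _).fderiv]
  have hq := T.q_ne
  simp only [Fin.sum_univ_two, add_apply, smul_apply,
    smul_eq_mul, dX_single, dY_single, modeEigenvalue, mode]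
  generalize Real.cos (m * Real.pi * T.X y) * Real.cos (n * Real.pi * T.Y y) = k1
  generalize Real.cos (m * Real.pi * (1 - T.Y y)) * Real.cos (n * Real.pi * (1 - T.X y)) = k2
  generalize Real.sin (m * Real.pi * T.X y) * Real.sin (n * Real.pi * T.Y y) +
    Real.sin (m * Real.pi * (1 - T.Y y)) * Real.sin (n * Real.pi * (1 - T.X y)) = k3
  have h1 := T.sq_b
  have h2 := T.sq_c
  have h3 := T.ortho
  field_simp
  linear_combination (-(m : ℝ) ^ 2 * k1 - n ^ 2 * k2) * h1 + (-(n : ℝ) ^ 2 * k1 - m ^ 2 * k2) * h2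
    + 2 * m * n * k3 * h3

/-- Integrality of `n` enters here: `sin (nπ(1 - t))` is `± sin (nπt)`, so the mirrored term of a
mode also satisfies the Neumann condition on the legs. -/
lemma abs_sin_int_mul_pi_one_sub (n : ℤ) (t : ℝ) :
    |Real.sin (n * Real.pi * (1 - t))| ≤ |n * Real.pi| * |t| := by
  have : Real.sin (n * Real.pi * (1 - t)) = -(Real.cos (n * Real.pi) * Real.sin (n * Real.pi * t)) := by
    rw [mul_sub, mul_one, Real.sin_sub, Real.sin_int_mul_pi]; ring
  rw [this, abs_neg, abs_mul, ← abs_mul (n * Real.pi)]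
  refine (mul_le_of_le_one_left (abs_nonneg _) (Real.abs_cos_le_one _)).trans ?_
  simpa only [Real.sin_zero, sub_zero] using Real.abs_sin_sub_sin_le (n * Real.pi * t) 0

lemma abs_mul_trig_le {a s t r p : ℝ} (hs : |s| ≤ r * p) (ht : |t| ≤ 1) :
    |a * (s * t)| ≤ |a| * r * p := by
  rw [abs_mul, abs_mul, mul_assoc]
  refine mul_le_mul_of_nonneg_left ?_ (abs_nonneg a)
  calc |s| * |t| ≤ |s| * 1 := by gcongr
    _ ≤ _ := by rwa [mul_one]

lemma abs_modeX_le (m n : ℤ) {y : Plane} (h : 0 ≤ T.X y) :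
    |T.modeX m n y| ≤ ((m * Real.pi) ^ 2 + (n * Real.pi) ^ 2) * T.X y := by
  unfold modeX
  have h1 : |Real.sin (m * Real.pi * T.X y)| ≤ |m * Real.pi| * T.X y := by
    have := Real.abs_sin_sub_sin_le (m * Real.pi * T.X y) 0
    simpa [abs_mul, abs_of_nonneg h] using this
  have h2 := abs_sin_int_mul_pi_one_sub n (T.X y)
  rw [abs_of_nonneg h] at h2
  have h3 := abs_mul_trig_le (a := -(m * Real.pi)) h1 (Real.abs_cos_le_one (n * Real.pi * T.Y y))
  have h4 := abs_mul_trig_le (a := n * Real.pi) h2 (Real.abs_cos_le_one (m * Real.pi * (1 - T.Y y)))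
  refine (abs_add_le _ _).trans ?_
  rw [mul_comm (Real.cos (m * Real.pi * (1 - T.Y y)))]
  rw [abs_neg, ← abs_mul, abs_mul_self] at h3
  rw [← abs_mul, abs_mul_self] at h4
  linarith

lemma abs_modeY_le (m n : ℤ) {y : Plane} (h : 0 ≤ T.Y y) :
    |T.modeY m n y| ≤ ((m * Real.pi) ^ 2 + (n * Real.pi) ^ 2) * T.Y y := by
  unfold modeY
  have h1 : |Real.sin (n * Real.pi * T.Y y)| ≤ |n * Real.pi| * T.Y y := by
    have := Real.abs_sin_sub_sin_le (n * Real.pi * T.Y y) 0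
    simpa [abs_mul, abs_of_nonneg h] using this
  have h2 := abs_sin_int_mul_pi_one_sub m (T.Y y)
  rw [abs_of_nonneg h] at h2
  have h3 := abs_mul_trig_le (a := -(n * Real.pi)) h1 (Real.abs_cos_le_one (m * Real.pi * T.X y))
  have h4 := abs_mul_trig_le (a := m * Real.pi) h2 (Real.abs_cos_le_one (n * Real.pi * (1 - T.X y)))
  refine (abs_add_le _ _).trans ?_
  rw [mul_comm (Real.cos (m * Real.pi * T.X y))]
  rw [abs_neg, ← abs_mul, abs_mul_self] at h3
  rw [← abs_mul, abs_mul_self] at h4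
  linarith

lemma abs_mul_sub_mul_le {a a' b b' r : ℝ} (ha : |a - a'| ≤ r) (hb : |b - b'| ≤ r)
    (h1 : |a'| ≤ 1) (h2 : |b| ≤ 1) : |a * b - a' * b'| ≤ 2 * r := by
  have : a * b - a' * b' = (a - a') * b + a' * (b - b') := by ring
  rw [this]
  refine (abs_add_le _ _).trans ?_
  rw [abs_mul, abs_mul]
  have hr : 0 ≤ r := (abs_nonneg _).trans ha
  have e1 : |a - a'| * |b| ≤ r * 1 := by gcongr
  have e2 : |a'| * |b - b'| ≤ 1 * r := by gcongr
  linarith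

/-- On the hypotenuse `1 - Y = X` and `1 - X = Y`, so each term of the normal derivative cancels
against its mirror image. Off it, the arguments of paired terms differ by a multiple of `1 - X - Y`,
and the Lipschitz bounds for sine and cosine give linear decay. -/
lemma abs_modeX_add_modeY_le (m n : ℤ) {y : Plane} (h : 0 ≤ 1 - T.X y - T.Y y) :
    |T.modeX m n y + T.modeY m n y| ≤
      2 * (|m * Real.pi| + |n * Real.pi|) ^ 2 * (1 - T.X y - T.Y y) := by
  set R := |m * Real.pi| + |n * Real.pi| with hR
  set d := 1 - T.X y - T.Y y with hd
  have hm : |m * Real.pi| ≤ R := by rw [hR]; linarith [abs_nonneg (n * Real.pi)]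
  have hn : |n * Real.pi| ≤ R := by rw [hR]; linarith [abs_nonneg (m * Real.pi)]
  have arg : ∀ k s t : ℝ, |k| ≤ R → s - t = d → |k * s - k * t| ≤ R * d := by
    intro k s t hk hst
    rw [← mul_sub, hst, abs_mul, abs_of_nonneg h]
    gcongr
  have e1 : (1 - T.Y y) - T.X y = d := by rw [hd]; ring
  have e2 : (1 - T.X y) - T.Y y = d := rfl
  have b1 : |Real.sin (m * Real.pi * (1 - T.Y y)) * Real.cos (n * Real.pi * (1 - T.X y)) -
      Real.sin (m * Real.pi * T.X y) * Real.cos (n * Real.pi * T.Y y)| ≤ 2 * (R * d) :=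
    abs_mul_sub_mul_le ((Real.abs_sin_sub_sin_le _ _).trans (arg _ _ _ hm e1))
      ((Real.abs_cos_sub_cos_le _ _).trans (arg _ _ _ hn e2)) (Real.abs_sin_le_one _)
      (Real.abs_cos_le_one _)
  have b2 : |Real.cos (m * Real.pi * (1 - T.Y y)) * Real.sin (n * Real.pi * (1 - T.X y)) -
      Real.cos (m * Real.pi * T.X y) * Real.sin (n * Real.pi * T.Y y)| ≤ 2 * (R * d) :=
    abs_mul_sub_mul_le ((Real.abs_cos_sub_cos_le _ _).trans (arg _ _ _ hm e1))
      ((Real.abs_sin_sub_sin_le _ _).trans (arg _ _ _ hn e2)) (Real.abs_cos_le_one _)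
      (Real.abs_sin_le_one _)
  have : T.modeX m n y + T.modeY m n y = m * Real.pi *
      (Real.sin (m * Real.pi * (1 - T.Y y)) * Real.cos (n * Real.pi * (1 - T.X y)) -
      Real.sin (m * Real.pi * T.X y) * Real.cos (n * Real.pi * T.Y y)) + n * Real.pi *
      (Real.cos (m * Real.pi * (1 - T.Y y)) * Real.sin (n * Real.pi * (1 - T.X y)) -
      Real.cos (m * Real.pi * T.X y) * Real.sin (n * Real.pi * T.Y y)) := by
    unfold modeX modeY; ring
  rw [this]
  refine (abs_add_le _ _).trans ?_
  rw [abs_mul, abs_mul (n * Real.pi)]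
  calc _ ≤ |m * Real.pi| * (2 * (R * d)) + |n * Real.pi| * (2 * (R * d)) := by gcongr
    _ = _ := by ring

/-- The orthogonality of the frame, with both legs of squared length `q`, diagonalizes the pairing
of differentials; the normal derivative on each edge becomes a combination of `modeX` and `modeY`.
-/
lemma sum_gradMode_mul (m n : ℤ) (y : Plane) {s t : ℝ} {L : Plane →L[ℝ] ℝ}
    (hL : L = s • T.dX + t • T.dY) :
    ∑ i, T.gradMode m n i y * L (EuclideanSpace.single i 1) =
      (s * T.modeX m n y + t * T.modeY m n y) / T.q := by
  have hq := T.q_ne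
  have h1 := T.sq_b
  have h2 := T.sq_c
  have h3 := T.ortho
  simp only [hL, Fin.sum_univ_two, gradMode, add_apply,
    smul_apply, smul_eq_mul, dX_single, dY_single]
  field_simp
  linear_combination (s * T.modeX m n y) * h1 + t * T.modeY m n y * h2 +
    (t * T.modeX m n y + s * T.modeY m n y) * h3

lemma exists_bound_gradMode_normal (m n : ℤ) : ∃ C, ∀ j, ∀ y ∈ T.domain,
    |∑ i, T.gradMode m n i y * fderiv ℝ (T.side j) y (EuclideanSpace.single i 1)| ≤
      C * T.side j y := by
  set C1 := (m * Real.pi) ^ 2 + (n * Real.pi) ^ 2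
  set C2 := 2 * (|m * Real.pi| + |n * Real.pi|) ^ 2
  have hC1 : 0 ≤ C1 := by positivity
  have hC2 : 0 ≤ C2 := by positivity
  have hq := T.q_pos
  refine ⟨(C1 + C2) / T.q, fun j y hy => ?_⟩
  have hy' := T.mem_domain.1 hy
  have main : ∀ s t d : ℝ, 0 ≤ d → fderiv ℝ (T.side j) y = s • T.dX + t • T.dY →
      (|s * T.modeX m n y + t * T.modeY m n y| ≤ C1 * d ∨
        |s * T.modeX m n y + t * T.modeY m n y| ≤ C2 * d) →
      |∑ i, T.gradMode m n i y * fderiv ℝ (T.side j) y (EuclideanSpace.single i 1)| ≤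
      (C1 + C2) / T.q * d := by
    intro s t d hd hL hle
    rw [T.sum_gradMode_mul m n y hL, abs_div, abs_of_pos hq, div_mul_eq_mul_div]
    refine div_le_div_of_nonneg_right ?_ hq.le
    rw [add_mul]
    rcases hle with h | h
    · exact h.trans (le_add_of_nonneg_right (by positivity))
    · exact h.trans (le_add_of_nonneg_left (by positivity))
  fin_cases j
  · refine main 1 0 (T.X y) hy'.1.le ?_ (Or.inl ?_)
    · rw [one_smul, zero_smul, add_zero]; exact (T.hasFDerivAt_X y).fderiv
    · simpa using T.abs_modeX_le m n hy'.1.le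
  · refine main 0 1 (T.Y y) hy'.2.1.le ?_ (Or.inl ?_)
    · rw [one_smul, zero_smul, zero_add]; exact (T.hasFDerivAt_Y y).fderiv
    · simpa using T.abs_modeY_le m n hy'.2.1.le
  · have hd : 0 ≤ 1 - T.X y - T.Y y := by linarith
    refine main (-1) (-1) (1 - T.X y - T.Y y) hd ?_ (Or.inr ?_)
    · refine (((T.hasFDerivAt_X y).const_sub 1).sub (T.hasFDerivAt_Y y)).fderiv.trans ?_
      ext v
      simp
      ring
    · have := T.abs_modeX_add_modeY_le m n hd
      rw [← abs_neg] at this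
      convert this using 2
      ring

/-! ### Green's formula for the modes and orthogonality -/

/-- The class of `mode m n` in `L²`. -/
noncomputable def modeL2 (m n : ℤ) : L2 T.domain := T.toL2 (T.mode m n) (T.continuous_mode m n)

/-- The class of the gradient of `mode m n` in `L²`. -/
noncomputable def gradModeL2 (m n : ℤ) (i : Fin 2) : L2 T.domain :=
  T.toL2 (T.gradMode m n i) (T.continuous_gradMode m n i)

lemma hasWeakGradient_modeL2 (m n : ℤ) :
    HasWeakGradient T.domain (T.modeL2 m n) (T.gradModeL2 m n) :=
  hasWeakGradient_continuousToL2 T.measurableSet_domain T.isBounded_domain (T.contDiff_mode m n) (T.continuous_gradMode m n)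
    (T.fderiv_mode m n)

/-- Because `v` is an arbitrary `H¹` function, this serves twice: to make the mode an eigenfunction,
and to test it against an unknown eigenfunction. -/
lemma sum_inner_gradModeL2 (m n : ℤ) {v : L2 T.domain} {H : Fin 2 → L2 T.domain}
    (h : HasWeakGradient T.domain v H) :
    ∑ i, inner ℂ (T.gradModeL2 m n i) (H i) =
      (T.modeEigenvalue m n : ℂ) * inner ℂ (T.modeL2 m n) v := by
  obtain ⟨C, hC⟩ := T.exists_bound_gradMode_normal m n
  have := HasWeakGradient.integral_by_parts (ω := T.domain) (fun j => T.contDiff_side j)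
    rfl T.isBounded_domain (fun i => T.contDiff_gradMode m n i) hC h
  simp only [gradModeL2, modeL2, inner_continuousToL2_left]
  rw [this, ← integral_neg, ← integral_const_mul]
  refine integral_congr_ae (Eventually.of_forall fun y => ?_)
  simp only [div_gradMode]
  simp [mul_assoc]

lemma modeL2_mem_eigenspace (m n : ℤ) :
    T.modeL2 m n ∈ neumannEigenspace T.domain (T.modeEigenvalue m n) := by
  refine mem_neumannEigenspace.2 ⟨T.gradModeL2 m n, T.hasWeakGradient_modeL2 m n, fun v H h => ?_⟩
  have := congrArg (starRingEnd ℂ) (T.sum_inner_gradModeL2 m n h)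
  rw [map_sum, map_mul, Complex.conj_ofReal] at this
  simp only [inner_conj_symm] at this
  exact this

/-- The Dirichlet pairing of `u` with the mode is evaluated by both eigenvalue equations, each
function serving as test function for the other. -/
lemma inner_modeL2_eq_zero {μ : ℝ} {u : L2 T.domain} (hu : u ∈ neumannEigenspace T.domain μ)
    {m n : ℤ} (hne : μ ≠ T.modeEigenvalue m n) : inner ℂ (T.modeL2 m n) u = 0 := by
  obtain ⟨G, hG, h⟩ := mem_neumannEigenspace.1 hu
  have h1 := h _ _ (T.hasWeakGradient_modeL2 m n)
  have h2 := T.sum_inner_gradModeL2 m n hG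
  rw [h2] at h1
  have h3 : ((T.modeEigenvalue m n : ℂ) - μ) * inner ℂ (T.modeL2 m n) u = 0 := by
    linear_combination h1
  refine (mul_eq_zero.1 h3).resolve_left fun h4 => hne ?_
  have := sub_eq_zero.1 h4
  exact_mod_cast this.symm

lemma mode_zero_zero (y : Plane) : T.mode 0 0 y = 2 := by
  simp [mode]; norm_num

lemma mode_one_zero (y : Plane) :
    T.mode 1 0 y = Real.cos (Real.pi * T.X y) - Real.cos (Real.pi * T.Y y) := by
  have : Real.pi * (1 - T.Y y) = Real.pi - Real.pi * T.Y y := by ring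
  simp [mode, this, Real.cos_pi_sub]
  ring

lemma mode_one_one (y : Plane) :
    T.mode 1 1 y = 2 * (Real.cos (Real.pi * T.X y) * Real.cos (Real.pi * T.Y y)) := by
  have h1 : Real.pi * (1 - T.X y) = Real.pi - Real.pi * T.X y := by ring
  have h2 : Real.pi * (1 - T.Y y) = Real.pi - Real.pi * T.Y y := by ring
  simp [mode, h1, h2, Real.cos_pi_sub]
  ring

/-! ### Completeness of the modes -/

lemma cos_int_mul_pi_one_sub (n : ℤ) (t : ℝ) :
    Real.cos (n * Real.pi * (1 - t)) = Real.cos (n * Real.pi) * Real.cos (n * Real.pi * t) := by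
  rw [mul_sub, mul_one, Real.cos_sub, Real.sin_int_mul_pi]; ring

lemma cos_int_mul_pi_eq (n : ℤ) (t : ℝ) :
    Real.cos (n * Real.pi * t) = Real.cos (n * Real.pi) * Real.cos (n * Real.pi * (1 - t)) := by
  rw [← cos_int_mul_pi_one_sub, sub_sub_cancel]

/-- Up to the sign `cos kπ · cos lπ`, each summand of `mode k l` equals the other with `k` and `l`
exchanged. Hence in the product every summand of `mode m n` can be paired with cosines of the same
arguments, and product-to-sum formulas return modes. -/
lemma mode_mul_mode (m n k l : ℤ) (y : Plane) :
    T.mode m n y * T.mode k l y =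
      1 / 4 * (T.mode (m + k) (n + l) y + T.mode (m + k) (n - l) y +
        T.mode (m - k) (n + l) y + T.mode (m - k) (n - l) y) +
      Real.cos (k * Real.pi) * Real.cos (l * Real.pi) / 4 *
        (T.mode (m + l) (n + k) y + T.mode (m + l) (n - k) y +
        T.mode (m - l) (n + k) y + T.mode (m - l) (n - k) y) := by
  have h1 : Real.cos (k * Real.pi * (1 - T.Y y)) * Real.cos (l * Real.pi * (1 - T.X y)) =
      Real.cos (k * Real.pi) * Real.cos (l * Real.pi) *
        (Real.cos (l * Real.pi * T.X y) * Real.cos (k * Real.pi * T.Y y)) := by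
    rw [cos_int_mul_pi_one_sub, cos_int_mul_pi_one_sub]; ring
  have h2 : Real.cos (k * Real.pi * T.X y) * Real.cos (l * Real.pi * T.Y y) =
      Real.cos (k * Real.pi) * Real.cos (l * Real.pi) *
        (Real.cos (l * Real.pi * (1 - T.Y y)) * Real.cos (k * Real.pi * (1 - T.X y))) := by
    rw [cos_int_mul_pi_eq k, cos_int_mul_pi_eq l]; ring
  simp only [mode, Int.cast_add, Int.cast_sub, add_mul, sub_mul, Real.cos_add, Real.cos_sub]
  linear_combination (Real.cos (m * Real.pi * T.X y) * Real.cos (n * Real.pi * T.Y y)) * h1 +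
    (Real.cos (m * Real.pi * (1 - T.Y y)) * Real.cos (n * Real.pi * (1 - T.X y))) * h2

/-- `mode m n` as a bundled continuous function. -/
noncomputable def modeMap (p : ℤ × ℤ) : C(Plane, ℝ) := ⟨T.mode p.1 p.2, T.continuous_mode p.1 p.2⟩

lemma mul_mem_span_modeMap {f g : C(Plane, ℝ)} (hf : f ∈ Submodule.span ℝ (range T.modeMap))
    (hg : g ∈ Submodule.span ℝ (range T.modeMap)) :
    f * g ∈ Submodule.span ℝ (range T.modeMap) := by
  have hmem : ∀ m n, T.modeMap (m, n) ∈ Submodule.span ℝ (range T.modeMap) := fun m n =>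
    Submodule.subset_span ⟨_, rfl⟩
  have h := Submodule.mul_mem_mul hf hg
  rw [Submodule.span_mul_span] at h
  refine Submodule.span_le.2 ?_ h
  rintro _ ⟨_, ⟨⟨m, n⟩, rfl⟩, _, ⟨⟨k, l⟩, rfl⟩, rfl⟩
  have : T.modeMap (m, n) * T.modeMap (k, l) =
      (1 / 4 : ℝ) • (T.modeMap (m + k, n + l) + T.modeMap (m + k, n - l) +
        T.modeMap (m - k, n + l) + T.modeMap (m - k, n - l)) +
      (Real.cos (k * Real.pi) * Real.cos (l * Real.pi) / 4) •
        (T.modeMap (m + l, n + k) + T.modeMap (m + l, n - k) +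
        T.modeMap (m - l, n + k) + T.modeMap (m - l, n - k)) := by
    ext y
    exact T.mode_mul_mode m n k l y
  simp only [SetLike.mem_coe, this]
  refine Submodule.add_mem _ (Submodule.smul_mem _ _ ?_) (Submodule.smul_mem _ _ ?_) <;>
  exact Submodule.add_mem _ (Submodule.add_mem _ (Submodule.add_mem _ (hmem _ _) (hmem _ _))
    (hmem _ _)) (hmem _ _)

lemma one_mem_span_modeMap : (1 : C(Plane, ℝ)) ∈ Submodule.span ℝ (range T.modeMap) := by
  have : (1 : C(Plane, ℝ)) = (1 / 2 : ℝ) • T.modeMap (0, 0) := by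
    ext y
    simp [modeMap, mode_zero_zero]
  rw [this]
  exact Submodule.smul_mem _ _ (Submodule.subset_span ⟨_, rfl⟩)

/-- The algebra spanned by the modes. -/
noncomputable def modeAlgebra : Subalgebra ℝ C(Plane, ℝ) :=
  (Submodule.span ℝ (range T.modeMap)).toSubalgebra T.one_mem_span_modeMap
    fun _ _ hf hg => T.mul_mem_span_modeMap hf hg

/-- The two modes determine the sum and the product of `cos πX` and `-cos πY`, hence this pair up to
order. Exchanging the two entries is the reflection in the hypotenuse, which maps no point of the
closed triangle to a different point of it. -/
lemma eq_of_cos_eq {y z : Plane} (hy : y ∈ T.closedDomain) (hz : z ∈ T.closedDomain)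
    (h0 : T.mode 1 0 y = T.mode 1 0 z) (h1 : T.mode 1 1 y = T.mode 1 1 z) : y = z := by
  rw [mem_closedDomain] at hy hz
  rw [mode_one_zero, mode_one_zero] at h0
  rw [mode_one_one, mode_one_one] at h1
  have hπ := Real.pi_pos
  have inj : ∀ s t : ℝ, 0 ≤ s → s ≤ 1 → 0 ≤ t → t ≤ 1 →
      Real.cos (Real.pi * s) = Real.cos (Real.pi * t) → s = t := by
    intro s t hs hs' ht ht' h
    have := Real.injOn_cos ⟨by positivity, by nlinarith⟩ ⟨by positivity, by nlinarith⟩ h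
    exact mul_left_cancel₀ hπ.ne' this
  have hprod : (Real.cos (Real.pi * T.X y) - Real.cos (Real.pi * T.X z)) *
      (Real.cos (Real.pi * T.X y) + Real.cos (Real.pi * T.Y z)) = 0 := by
    linear_combination Real.cos (Real.pi * T.X y) * h0 + h1 / 2
  have hX : T.X y = T.X z ∧ T.Y y = T.Y z := by
    rcases mul_eq_zero.1 hprod with h | h
    · have h' : Real.cos (Real.pi * T.Y y) = Real.cos (Real.pi * T.Y z) := by linarith
      exact ⟨inj _ _ hy.1 (by linarith) hz.1 (by linarith) (by linarith),
        inj _ _ hy.2.1 (by linarith) hz.2.1 (by linarith) h'⟩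
    -- The exchanged case: `z` is the mirror image of `y`. As both satisfy `X + Y ≤ 1`, both lie on
    -- the hypotenuse and coincide.
    · have e : ∀ t, Real.cos (Real.pi * (1 - t)) = -Real.cos (Real.pi * t) := fun t => by
        rw [mul_sub, mul_one, Real.cos_pi_sub]
      have h2 : T.X y = 1 - T.Y z :=
        inj _ _ hy.1 (by linarith) (by linarith) (by linarith) (by rw [e]; linarith)
      have h3 : T.Y y = 1 - T.X z :=
        inj _ _ hy.2.1 (by linarith) (by linarith) (by linarith) (by rw [e]; linarith)
      constructor <;> linarith
  rw [T.eq_point y, T.eq_point z, hX.1, hX.2]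

lemma exists_mem_span_modeMap_near {f : Plane → ℝ} (hf : Continuous f) {ε : ℝ} (hε : 0 < ε) :
    ∃ g ∈ Submodule.span ℝ (range T.modeMap), ∀ y ∈ T.closedDomain, |g y - f y| < ε := by
  have : CompactSpace T.closedDomain := isCompact_iff_compactSpace.1 T.isCompact_closedDomain
  let r : C(Plane, ℝ) →ₐ[ℝ] C(T.closedDomain, ℝ) :=
    ContinuousMap.compRightAlgHom ℝ ℝ ⟨Subtype.val, continuous_subtype_val⟩
  have hmem : ∀ p, r (T.modeMap p) ∈ T.modeAlgebra.map r := fun p =>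
    ⟨_, Submodule.subset_span ⟨p, rfl⟩, rfl⟩
  have hsep : (T.modeAlgebra.map r).SeparatesPoints := by
    rintro ⟨y, hy⟩ ⟨z, hz⟩ hne
    by_contra hcon
    push Not at hcon
    refine hne (Subtype.ext (T.eq_of_cos_eq hy hz ?_ ?_))
    · exact hcon _ ⟨_, hmem (1, 0), rfl⟩
    · exact hcon _ ⟨_, hmem (1, 1), rfl⟩
  obtain ⟨⟨_, g, hg, rfl⟩, hgf⟩ :=
    ContinuousMap.exists_mem_subalgebra_near_continuous_of_separatesPoints _ hsep
      (fun y : T.closedDomain => f y) (hf.comp continuous_subtype_val) ε hε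
  exact ⟨g, hg, fun y hy => hgf ⟨y, hy⟩⟩

/-- The modes span a dense subspace of `L²` of the triangle. -/
theorem eq_zero_of_inner_modeL2 {u : L2 T.domain}
    (h : ∀ m n, inner ℂ (T.modeL2 m n) u = 0) : u = 0 := by
  have hint : ∀ {f : Plane → ℝ}, Continuous f →
      Integrable (fun y => f y • u y) (volume.restrict T.domain) := fun hf =>
    integrable_continuous_smul_L2 T.measurableSet_domain T.isBounded_domain u hf
  have hu := integrable_coeFn_L2 T.isBounded_domain u
  have hspan : ∀ g ∈ Submodule.span ℝ (range T.modeMap), ∫ y in T.domain, g y • u y = 0 := by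
    intro g hg
    induction hg using Submodule.span_induction with
    | mem g hg =>
      obtain ⟨p, rfl⟩ := hg
      rw [← h p.1 p.2, modeL2, inner_continuousToL2_left]
      rfl
    | zero => simp
    | add f g _ _ hf hg =>
      simp only [ContinuousMap.add_apply, add_smul]
      rw [integral_add (hint f.continuous) (hint g.continuous), hf, hg, add_zero]
    | smul a g _ hg =>
      simp only [ContinuousMap.smul_apply, smul_assoc]
      rw [integral_smul, hg, smul_zero]
  have hcont : ∀ f : Plane → ℝ, Continuous f → ∫ y in T.domain, f y • u y = 0 := by
    intro f hf
    rw [← norm_le_zero_iff]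
    refine le_of_forall_pos_le_add fun δ hδ => ?_
    set M := ∫ y in T.domain, ‖u y‖ with hM
    have hM0 : 0 ≤ M := integral_nonneg fun _ => norm_nonneg _
    -- The tolerance makes the error at most `δ * M / (M + 1)`; the `+ 1` covers `M = 0`.
    obtain ⟨g, hg, hgf⟩ := T.exists_mem_span_modeMap_near hf (ε := δ / (M + 1)) (by positivity)
    have : ∫ y in T.domain, f y • u y = ∫ y in T.domain, (f y - g y) • u y := by
      simp only [sub_smul]
      rw [integral_sub (hint hf) (hint g.continuous), hspan g hg, sub_zero]
    rw [this, zero_add]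
    calc _ ≤ ∫ y in T.domain, δ / (M + 1) * ‖u y‖ := by
          refine norm_integral_le_of_norm_le (hu.norm.const_mul _) ?_
          filter_upwards [ae_restrict_mem T.measurableSet_domain] with y hy
          rw [norm_smul]
          refine mul_le_mul_of_nonneg_right ?_ (norm_nonneg _)
          rw [norm_sub_rev]
          exact (hgf y (T.domain_subset hy)).le
      _ = δ / (M + 1) * M := integral_const_mul _ _
      _ ≤ δ := by
          rw [div_mul_eq_mul_div, div_le_iff₀ (by positivity)]
          nlinarith
  have := T.isOpen_domain.ae_eq_zero_of_integral_contDiff_smul_eq_zero (f := u)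
    (μ := volume.restrict T.domain) (hu.locallyIntegrable.locallyIntegrableOn _)
    fun g hg _ _ => hcont g hg.continuous
  rw [Lp.eq_zero_iff_ae_eq_zero]
  filter_upwards [this, ae_restrict_mem T.measurableSet_domain] with y hy hyd
  exact hy hyd

/-! ### The two lowest eigenvalues -/

lemma inner_toL2 {f g : Plane → ℝ} (hf : Continuous f) (hg : Continuous g) :
    inner ℂ (T.toL2 f hf) (T.toL2 g hg) = ((∫ y in T.domain, f y * g y : ℝ) : ℂ) := by
  rw [inner_continuousToL2_left, ← integral_complex_ofReal]
  refine integral_congr_ae ?_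
  filter_upwards [coeFn_continuousToL2 T.measurableSet_domain T.isBounded_domain hg] with y hy
  rw [hy]
  simp

/-- The second eigenvalue. -/
noncomputable def gap : ℝ := Real.pi ^ 2 / T.q

lemma gap_pos : 0 < T.gap := div_pos (by positivity) T.q_pos

lemma modeEigenvalue_zero : T.modeEigenvalue 0 0 = 0 := by simp [modeEigenvalue]

lemma modeEigenvalue_one : T.modeEigenvalue 1 0 = T.gap := by simp [modeEigenvalue, gap]

lemma modeEigenvalue_eq (m n : ℤ) : T.modeEigenvalue m n = T.gap * ((m ^ 2 + n ^ 2 : ℤ) : ℝ) := by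
  simp only [modeEigenvalue, gap]
  push_cast
  ring

lemma gap_le_modeEigenvalue {m n : ℤ} (h : ¬(m = 0 ∧ n = 0)) : T.gap ≤ T.modeEigenvalue m n := by
  have h1 : (1 : ℤ) ≤ m ^ 2 + n ^ 2 := by
    by_contra hcon
    have hm : m = 0 := by nlinarith [sq_nonneg m, sq_nonneg n]
    have hn : n = 0 := by nlinarith [sq_nonneg m, sq_nonneg n]
    exact h ⟨hm, hn⟩
  rw [modeEigenvalue_eq]
  exact le_mul_of_one_le_right T.gap_pos.le (by exact_mod_cast h1)

lemma integral_mode_eq_zero {m n : ℤ} (h : ¬(m = 0 ∧ n = 0)) :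
    ∫ y in T.domain, T.mode m n y = 0 := by
  have h0 := T.modeL2_mem_eigenspace 0 0
  rw [modeEigenvalue_zero] at h0
  have := T.inner_modeL2_eq_zero h0
    (T.gap_pos.trans_le (T.gap_le_modeEigenvalue h)).ne
  rw [modeL2, modeL2, inner_toL2] at this
  simp only [mode_zero_zero, Complex.ofReal_eq_zero] at this
  rw [integral_mul_const] at this
  linarith

lemma integrable_of_continuous {f : Plane → ℝ} (hf : Continuous f) :
    IntegrableOn f T.domain :=
  (hf.continuousOn.integrableOn_compact T.isCompact_closedDomain).mono_set T.domain_subset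

/-- The product formula writes the square as `1` plus modes with nonzero index, which have mean zero
by orthogonality to constants. No double integral has to be evaluated. -/
lemma integral_mode_one_zero_sq :
    ∫ y in T.domain, T.mode 1 0 y * T.mode 1 0 y = volume.real T.domain := by
  have hi : ∀ m n, IntegrableOn (T.mode m n) T.domain := fun m n =>
    T.integrable_of_continuous (T.continuous_mode m n)
  have h : ∀ y, T.mode 1 0 y * T.mode 1 0 y =
      (1 / 2 * T.mode 2 0 y + 1) - (1 / 2 * T.mode 1 1 y + 1 / 2 * T.mode 1 (-1) y) := by
    intro y
    rw [mode_mul_mode]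
    norm_num [mode_zero_zero]
    ring
  simp only [h]
  rw [integral_sub, integral_add, integral_add, integral_const_mul, integral_const_mul,
    integral_const_mul, T.integral_mode_eq_zero (by simp), T.integral_mode_eq_zero (by simp),
    T.integral_mode_eq_zero (by simp)]
  · simp
  · exact (hi _ _).const_mul _
  · exact (hi _ _).const_mul _
  · exact (hi _ _).const_mul _
  · exact T.integrable_of_continuous continuous_const
  · exact ((hi _ _).const_mul _).add (T.integrable_of_continuous continuous_const)
  · exact ((hi _ _).const_mul _).add ((hi _ _).const_mul _)

lemma nonempty_domain : T.domain.Nonempty :=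
  ⟨T.A + ((1 / 3 : ℝ) • T.b + (1 / 3 : ℝ) • T.c), T.mem_domain.2 <| by
    rw [X_point, Y_point]; norm_num⟩

lemma volume_real_domain_pos : 0 < volume.real T.domain :=
  ENNReal.toReal_pos (T.isOpen_domain.measure_pos _ T.nonempty_domain).ne'
    T.isBounded_domain.measure_lt_top.ne

lemma inner_modeL2_one_self :
    inner ℂ (T.modeL2 1 0) (T.modeL2 1 0) = (volume.real T.domain : ℂ) := by
  rw [modeL2, inner_toL2, integral_mode_one_zero_sq]

lemma norm_sq_modeL2_one : ‖T.modeL2 1 0‖ ^ 2 = volume.real T.domain := by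
  have := T.inner_modeL2_one_self
  rw [inner_self_eq_norm_sq_to_K] at this
  apply Complex.ofReal_injective
  rw [Complex.ofReal_pow]
  exact this

lemma modeL2_one_ne_zero : T.modeL2 1 0 ≠ 0 := by
  intro h
  have := T.norm_sq_modeL2_one
  rw [h, norm_zero] at this
  have := T.volume_real_domain_pos
  simp_all

lemma modeL2_zero_ne_zero : T.modeL2 0 0 ≠ 0 := by
  intro h
  have : inner ℂ (T.modeL2 0 0) (T.modeL2 0 0) = (0 : ℂ) := by rw [h, inner_zero_left]
  rw [modeL2, inner_toL2] at this
  simp only [mode_zero_zero, Complex.ofReal_eq_zero] at this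
  have h2 := T.volume_real_domain_pos
  simp at this
  simp_all

/-- The difference of `u` and its projection to a nonzero vector `e` is orthogonal to `e`. -/
lemma inner_sub_proj {e : L2 T.domain} (he : e ≠ 0) (u : L2 T.domain) :
    inner ℂ e (u - (inner ℂ e u / inner ℂ e e : ℂ) • e) = 0 := by
  rw [inner_sub_right, inner_smul_right, div_mul_cancel₀ _ (inner_self_ne_zero.2 he), sub_self]

/-- After subtracting the projection to constants, nothing is left that correlates with any mode:
the nonconstant ones have eigenvalue at least `gap`, different from both `μ` and `0`. -/
lemma eigenspace_le_of_lt_gap {μ : ℝ} (h : μ < T.gap) :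
    neumannEigenspace T.domain μ ≤ Submodule.span ℂ {T.modeL2 0 0} := by
  intro u hu
  rw [Submodule.mem_span_singleton]
  refine ⟨inner ℂ (T.modeL2 0 0) u / inner ℂ (T.modeL2 0 0) (T.modeL2 0 0),
    (sub_eq_zero.1 (T.eq_zero_of_inner_modeL2 fun m n => ?_)).symm⟩
  by_cases hmn : m = 0 ∧ n = 0
  · rw [hmn.1, hmn.2]
    exact T.inner_sub_proj T.modeL2_zero_ne_zero u
  · have hle := T.gap_le_modeEigenvalue hmn
    have h0 := T.modeL2_mem_eigenspace 0 0
    rw [modeEigenvalue_zero] at h0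
    rw [inner_sub_right, inner_smul_right, T.inner_modeL2_eq_zero hu (h.trans_le hle).ne,
      T.inner_modeL2_eq_zero h0 (T.gap_pos.trans_le hle).ne, mul_zero, sub_zero]

lemma mode_zero_one (y : Plane) : T.mode 0 1 y = -T.mode 1 0 y := by
  have : Real.pi * (1 - T.X y) = Real.pi - Real.pi * T.X y := by ring
  rw [mode_one_zero]
  simp [mode, this, Real.cos_pi_sub]
  ring

lemma mode_neg_left (m n : ℤ) (y : Plane) : T.mode (-m) n y = T.mode m n y := by
  simp [mode]

lemma mode_neg_right (m n : ℤ) (y : Plane) : T.mode m (-n) y = T.mode m n y := by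
  simp [mode]

/-- Simplicity comes from here. The square has two independent modes at this level; symmetrization
leaves only one, since `mode 0 1` is the negative of `mode 1 0`. -/
lemma inner_modeL2_eq_zero_of_one {u : L2 T.domain} (h : inner ℂ (T.modeL2 1 0) u = 0) {m n : ℤ}
    (hmn : m ^ 2 + n ^ 2 = 1) : inner ℂ (T.modeL2 m n) u = 0 := by
  have key : ∀ s : ℝ, (∀ y, T.mode m n y = s * T.mode 1 0 y) → inner ℂ (T.modeL2 m n) u = 0 := by
    intro s hs
    rw [modeL2, inner_continuousToL2_left] at h ⊢
    simp only [hs, mul_smul]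
    rw [integral_smul, h, smul_zero]
  have hm : m ≤ 1 := by nlinarith [sq_nonneg n]
  have hm' : -1 ≤ m := by nlinarith [sq_nonneg n]
  have hn : n ≤ 1 := by nlinarith [sq_nonneg m]
  have hn' : -1 ≤ n := by nlinarith [sq_nonneg m]
  interval_cases m <;> interval_cases n <;> simp at hmn
  · exact key 1 fun y => by rw [mode_neg_left, one_mul]
  · exact key (-1) fun y => by rw [mode_neg_right, mode_zero_one]; ring
  · exact key (-1) fun y => by rw [mode_zero_one]; ring
  · exact h

lemma eigenspace_gap : neumannEigenspace T.domain T.gap = Submodule.span ℂ {T.modeL2 1 0} := by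
  have h1 := T.modeL2_mem_eigenspace 1 0
  rw [modeEigenvalue_one] at h1
  refine le_antisymm (fun u hu => ?_) ((Submodule.span_singleton_le_iff_mem _ _).2 h1)
  set a : ℂ := inner ℂ (T.modeL2 1 0) u / inner ℂ (T.modeL2 1 0) (T.modeL2 1 0) with ha
  rw [Submodule.mem_span_singleton]
  refine ⟨a, (sub_eq_zero.1 (T.eq_zero_of_inner_modeL2 fun m n => ?_)).symm⟩
  by_cases hmn : m ^ 2 + n ^ 2 = 1
  · exact T.inner_modeL2_eq_zero_of_one (T.inner_sub_proj T.modeL2_one_ne_zero u) hmn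
  · refine T.inner_modeL2_eq_zero (Submodule.sub_mem _ hu (Submodule.smul_mem _ _ h1)) ?_
    rw [modeEigenvalue_eq]
    intro hcon
    have : ((m ^ 2 + n ^ 2 : ℤ) : ℝ) = 1 := by
      have h0 := T.gap_pos.ne'
      field_simp at hcon
      linarith
    exact hmn (by exact_mod_cast this)

lemma finrank_eigenspace_gap : Module.finrank ℂ (neumannEigenspace T.domain T.gap) = 1 := by
  rw [eigenspace_gap]
  exact finrank_span_singleton T.modeL2_one_ne_zero

theorem neumannEigenvalue_two : neumannEigenvalue T.domain 2 = T.gap := by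
  -- The infimum is attained at `gap`: there the constant and `mode 1 0` are two orthogonal nonzero
  -- vectors.
  refine IsLeast.csInf_eq ⟨?_, fun t ht => ?_⟩
  · have h0 : T.modeL2 0 0 ∈ ⨆ μ ∈ Iic T.gap, neumannEigenspace T.domain μ := by
      refine Submodule.mem_iSup_of_mem 0 (Submodule.mem_iSup_of_mem T.gap_pos.le ?_)
      have := T.modeL2_mem_eigenspace 0 0
      rwa [modeEigenvalue_zero] at this
    have h1' : T.modeL2 1 0 ∈ neumannEigenspace T.domain T.gap := by
      have := T.modeL2_mem_eigenspace 1 0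
      rwa [modeEigenvalue_one] at this
    have h1 : T.modeL2 1 0 ∈ ⨆ μ ∈ Iic T.gap, neumannEigenspace T.domain μ :=
      Submodule.mem_iSup_of_mem T.gap (Submodule.mem_iSup_of_mem self_mem_Iic h1')
    have h01 : inner ℂ (T.modeL2 0 0) (T.modeL2 1 0) = (0 : ℂ) :=
      T.inner_modeL2_eq_zero h1' (by rw [modeEigenvalue_zero]; exact T.gap_pos.ne')
    have hind : LinearIndependent ℂ ![T.modeL2 0 0, T.modeL2 1 0] := by
      refine linearIndependent_of_ne_zero_of_inner_eq_zero ?_ ?_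
      · intro i
        fin_cases i
        · exact T.modeL2_zero_ne_zero
        · exact T.modeL2_one_ne_zero
      · intro i j hij
        fin_cases i <;> fin_cases j
        · exact absurd rfl hij
        · exact h01
        · exact inner_eq_zero_symm.1 h01
        · exact absurd rfl hij
    have hle : Submodule.span ℂ (range ![T.modeL2 0 0, T.modeL2 1 0]) ≤
        ⨆ μ ∈ Iic T.gap, neumannEigenspace T.domain μ := by
      rw [Submodule.span_le]
      rintro _ ⟨i, rfl⟩
      fin_cases i
      · exact h0
      · exact h1
    have hr := rank_span hind
    rw [Cardinal.mk_range_eq _ hind.injective, Cardinal.mk_fin] at hr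
    exact hr.symm.le.trans (Submodule.rank_mono hle)
  -- Below `gap` all eigenspaces lie in the line of constants, so the rank is at most `1`.
  · by_contra hlt
    rw [not_le] at hlt
    have hle : (⨆ μ ∈ Iic t, neumannEigenspace T.domain μ) ≤
        Submodule.span ℂ {T.modeL2 0 0} :=
      iSup₂_le fun μ hμ => T.eigenspace_le_of_lt_gap (lt_of_le_of_lt hμ hlt)
    rw [mem_ofPred_eq] at ht
    have h1 := (ht.trans (Submodule.rank_mono hle)).trans (rank_span_le _)
    rw [Cardinal.mk_singleton] at h1
    norm_num at h1

end IsoFrame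

/-! ### Boundary traces and integrals over segments -/

lemma boundaryTrace_eq_of_continuous {ω : Set Plane} (ho : IsOpen ω) (hb : Bornology.IsBounded ω)
    {u : L2 ω} {g : Plane → ℂ} (hg : Continuous g) (hu : ∀ᵐ y ∂(volume.restrict ω), u y = g y)
    {x : Plane} (hx : x ∈ closure ω) : boundaryTrace ω u x = g x := by
  refine Filter.Tendsto.limUnder_eq (Metric.tendsto_nhds.2 fun ε hε => ?_)
  obtain ⟨δ, hδ, hgδ⟩ := Metric.continuousAt_iff.1 hg.continuousAt (ε / 2) (half_pos hε)
  filter_upwards [Ioo_mem_nhdsGT hδ] with r hr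
  have hopen : IsOpen (Metric.ball x r ∩ ω) := Metric.isOpen_ball.inter ho
  have hne : (Metric.ball x r ∩ ω).Nonempty :=
    mem_closure_iff.1 hx _ Metric.isOpen_ball (Metric.mem_ball_self hr.1)
  -- Averages of values in a closed convex set stay in it. The radius `ε / 2` restores the strict
  -- inequality at the end.
  have hmem : ⨍ y in Metric.ball x r ∩ ω, u y ∈ Metric.closedBall (g x) (ε / 2) := by
    refine (convex_closedBall _ _).set_average_mem Metric.isClosed_closedBall
      (hopen.measure_pos _ hne).ne' (hb.subset inter_subset_right).measure_lt_top.ne ?_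
      ((integrable_coeFn_L2 hb u).mono_measure (Measure.restrict_mono inter_subset_right le_rfl))
    filter_upwards [ae_restrict_of_ae_restrict_of_subset inter_subset_right hu,
      ae_restrict_mem hopen.measurableSet] with y hy hyb
    rw [hy]
    exact (hgδ (lt_trans hyb.1 hr.2)).le
  exact lt_of_le_of_lt hmem (half_lt_self hε)

section Segment

variable {P D : Plane}

lemma isometry_unit_speed (hD : D ≠ 0) : Isometry fun s : ℝ => P + s • (‖D‖⁻¹ • D) := by
  refine Isometry.of_dist_eq fun s t => ?_
  rw [dist_add_left, dist_eq_norm, ← sub_smul, norm_smul, norm_smul, norm_inv, norm_norm,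
    inv_mul_cancel₀ (norm_ne_zero_iff.2 hD), mul_one, Real.dist_eq, Real.norm_eq_abs]

lemma image_unit_speed (hD : D ≠ 0) :
    (fun t : ℝ => P + t • D) '' Icc 0 1 =
      (fun s : ℝ => P + s • (‖D‖⁻¹ • D)) '' Icc 0 ‖D‖ := by
  have hn : 0 < ‖D‖ := norm_pos_iff.2 hD
  ext y
  constructor
  · rintro ⟨t, ht, rfl⟩
    refine ⟨t * ‖D‖, ⟨mul_nonneg ht.1 hn.le, mul_le_of_le_one_left hn.le ht.2⟩, ?_⟩
    simp only [smul_smul]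
    rw [mul_assoc, mul_inv_cancel₀ hn.ne', mul_one]
  · rintro ⟨s, hs, rfl⟩
    refine ⟨s / ‖D‖, ⟨div_nonneg hs.1 hn.le, (div_le_one hn).2 hs.2⟩, ?_⟩
    simp only [smul_smul, div_eq_mul_inv]

lemma hausdorffMeasure_image_segment_lt_top (hD : D ≠ 0) :
    Measure.hausdorffMeasure 1 ((fun t : ℝ => P + t • D) '' Icc 0 1) < ⊤ := by
  rw [image_unit_speed hD, (isometry_unit_speed hD).hausdorffMeasure_image (Or.inl zero_le_one),
    hausdorffMeasure_real]
  exact isCompact_Icc.measure_lt_top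

lemma setIntegral_hausdorffMeasure_segment (hD : D ≠ 0) (g : Plane → ℝ) :
    ∫ y in (fun t : ℝ => P + t • D) '' Icc 0 1, g y ∂(Measure.hausdorffMeasure 1) =
      ‖D‖ * ∫ t in (0 : ℝ)..1, g (P + t • D) := by
  have hn : 0 < ‖D‖ := norm_pos_iff.2 hD
  have hι := isometry_unit_speed (P := P) hD
  have hmap := hι.map_hausdorffMeasure (d := 1) (Or.inl zero_le_one)
  rw [hausdorffMeasure_real] at hmap
  -- An isometry pushes Lebesgue measure forward to Hausdorff measure on its range only, so the
  -- restriction to the segment first passes through the range.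
  rw [image_unit_speed hD, ← Measure.restrict_restrict_of_subset (image_subset_range _ _), ← hmap,
    hι.isClosedEmbedding.measurableEmbedding.setIntegral_map,
    preimage_image_eq _ hι.injective, integral_Icc_eq_integral_Ioc,
    ← intervalIntegral.integral_of_le hn.le]
  have := intervalIntegral.integral_comp_div (a := 0) (b := ‖D‖)
    (fun t => g (P + t • D)) hn.ne'
  rw [zero_div, div_self hn.ne', smul_eq_mul] at this
  rw [← this]
  simp only [smul_smul, div_eq_mul_inv]

end Segment

/-! ### Edges, corners and outward normals of the triangle -/

namespace IsoFrame

variable (T : IsoFrame)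

/-- The differentials of the side functions. -/
noncomputable def dSide : Fin 3 → Plane →L[ℝ] ℝ := ![T.dX, T.dY, -(T.dX + T.dY)]

lemma X_add (y v : Plane) : T.X (y + v) = T.X y + T.dX v := by
  simp only [X, map_sub, map_add]; ring

lemma Y_add (y v : Plane) : T.Y (y + v) = T.Y y + T.dY v := by
  simp only [Y, map_sub, map_add]; ring

lemma side_add (j : Fin 3) (y v : Plane) : T.side j (y + v) = T.side j y + T.dSide j v := by
  fin_cases j
  · exact T.X_add y v
  · exact T.Y_add y v
  · change 1 - T.X (y + v) - T.Y (y + v) = 1 - T.X y - T.Y y + -(T.dX v + T.dY v)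
    rw [X_add, Y_add]; ring

lemma side_lineMap (j : Fin 3) (y z : Plane) {s t : ℝ} (hst : s + t = 1) :
    T.side j (s • y + t • z) = s * T.side j y + t * T.side j z := by
  have h1 := T.side_add j T.A (y - T.A)
  have h2 := T.side_add j T.A (z - T.A)
  have h3 := T.side_add j T.A (s • (y - T.A) + t • (z - T.A))
  have e : T.A + (s • (y - T.A) + t • (z - T.A)) = s • y + t • z := by
    have : T.A = (s + t) • T.A := by rw [hst, one_smul]
    nth_rw 1 [this]
    module
  rw [add_sub_cancel] at h1 h2
  rw [e, map_add, map_smul, map_smul, smul_eq_mul, smul_eq_mul] at h3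
  rw [h3, h1, h2]
  linear_combination (-T.side j T.A) * hst

/-- Inner normal vectors of the three edges. -/
noncomputable def innerNormal : Fin 3 → Plane := ![T.b, T.c, -(T.b + T.c)]

/-- Direction vectors of the three edges. -/
noncomputable def edgeDir : Fin 3 → Plane := ![T.c, T.b, T.c - T.b]

/-- Initial points of the three edges. -/
noncomputable def edgeStart : Fin 3 → Plane := ![T.A, T.A, T.A + T.b]

lemma inner_innerNormal (j : Fin 3) (v : Plane) :
    inner ℝ v (T.innerNormal j) = T.q * T.dSide j v := by
  have hq := T.q_ne
  fin_cases j
  · simp [innerNormal, dSide, dX_apply, PiLp.inner_apply, Fin.sum_univ_two]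
    field_simp
  · simp [innerNormal, dSide, dY_apply, PiLp.inner_apply, Fin.sum_univ_two]
    field_simp
  · simp [innerNormal, dSide, dX_apply, dY_apply, PiLp.inner_apply, Fin.sum_univ_two]
    field_simp
    ring

lemma dSide_innerNormal_pos (j : Fin 3) : 0 < T.dSide j (T.innerNormal j) := by
  fin_cases j
  · change 0 < T.dX T.b
    rw [dX_b]; exact one_pos
  · change 0 < T.dY T.c
    rw [dY_c]; exact one_pos
  · change 0 < -(T.dX (-(T.b + T.c)) + T.dY (-(T.b + T.c)))
    simp only [map_neg, map_add, dX_b, dX_c, dY_b, dY_c]; norm_num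

lemma innerNormal_ne_zero (j : Fin 3) : T.innerNormal j ≠ 0 := by
  intro h
  have := T.dSide_innerNormal_pos j
  rw [h, map_zero] at this
  exact lt_irrefl _ this

/-- Each edge is as long as its chosen normal vector: `|b| = |c|`, and `|c - b| = |b + c|` by
orthogonality. Thus edge length and normalization of the normal cancel in the boundary integral. -/
lemma norm_edgeDir (j : Fin 3) : ‖T.edgeDir j‖ = ‖T.innerNormal j‖ := by
  have h1 := T.sq_b
  have h2 := T.sq_c
  have h3 := T.ortho
  rw [← sq_eq_sq₀ (norm_nonneg _) (norm_nonneg _), EuclideanSpace.real_norm_sq_eq,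
    EuclideanSpace.real_norm_sq_eq]
  fin_cases j
  · simp [edgeDir, innerNormal, Fin.sum_univ_two]
    linarith
  · simp [edgeDir, innerNormal, Fin.sum_univ_two]
    linarith
  · simp [edgeDir, innerNormal, Fin.sum_univ_two]
    linear_combination (-4) * h3

lemma edgeDir_ne_zero (j : Fin 3) : T.edgeDir j ≠ 0 := by
  rw [← norm_ne_zero_iff, norm_edgeDir, norm_ne_zero_iff]
  exact T.innerNormal_ne_zero j

/-- If a side function vanished at an interior point, a small step against the inner normal would
make it negative without leaving the closed triangle. -/
lemma interior_closedDomain : interior T.closedDomain = T.domain := by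
  refine Subset.antisymm (fun y hy j => ?_) (interior_maximal T.domain_subset T.isOpen_domain)
  refine lt_of_le_of_ne (interior_subset hy j) fun h0 => ?_
  have hc : Tendsto (fun t : ℝ => y + t • (-T.innerNormal j)) (𝓝[>] 0) (𝓝 y) := by
    have : Continuous fun t : ℝ => y + t • (-T.innerNormal j) := by fun_prop
    simpa using (this.tendsto 0).mono_left nhdsWithin_le_nhds
  obtain ⟨t, ht, ht0⟩ :=
    ((hc.eventually (isOpen_interior.mem_nhds hy)).and self_mem_nhdsWithin).exists
  have := interior_subset ht j
  rw [side_add, ← h0, map_smul, map_neg, smul_eq_mul] at this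
  have h1 := mul_pos (mem_Ioi.1 ht0) (T.dSide_innerNormal_pos j)
  linarith

lemma convex_closedDomain : Convex ℝ T.closedDomain := by
  intro y hy z hz s t hs ht hst j
  rw [T.side_lineMap j y z hst]
  exact add_nonneg (mul_nonneg hs (hy j)) (mul_nonneg ht (hz j))

lemma closure_domain : closure T.domain = T.closedDomain := by
  have h := T.convex_closedDomain.closure_interior_eq_closure_of_nonempty_interior (by
    rw [interior_closedDomain]; exact T.nonempty_domain)
  rwa [interior_closedDomain, T.isClosed_closedDomain.closure_eq] at h

lemma point_mem_closedDomain {s t : ℝ} (hs : 0 ≤ s) (ht : 0 ≤ t) (hst : s + t ≤ 1) :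
    T.A + (s • T.b + t • T.c) ∈ T.closedDomain :=
  T.mem_closedDomain.2 (by rw [X_point, Y_point]; exact ⟨hs, ht, hst⟩)

lemma openTriangle_eq : openTriangle T.A (T.A + T.b) (T.A + T.c) = T.domain := by
  rw [openTriangle, ← interior_closedDomain]
  congr 1
  refine Subset.antisymm (convexHull_min ?_ T.convex_closedDomain) fun y hy => ?_
  · rintro y (rfl | rfl | rfl)
    · simpa using T.point_mem_closedDomain (s := 0) (t := 0) le_rfl le_rfl (by norm_num)
    · simpa using T.point_mem_closedDomain (s := 1) (t := 0) zero_le_one le_rfl (by norm_num)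
    · simpa using T.point_mem_closedDomain (s := 0) (t := 1) le_rfl zero_le_one (by norm_num)
  · obtain ⟨h1, h2, h3⟩ := T.mem_closedDomain.1 hy
    have hA : T.A ∈ convexHull ℝ {T.A, T.A + T.b, T.A + T.c} :=
      subset_convexHull _ _ (by simp)
    have hB : T.A + T.b ∈ convexHull ℝ {T.A, T.A + T.b, T.A + T.c} :=
      subset_convexHull _ _ (by simp)
    have hC : T.A + T.c ∈ convexHull ℝ {T.A, T.A + T.b, T.A + T.c} :=
      subset_convexHull _ _ (by simp)
    have := (convex_convexHull ℝ {T.A, T.A + T.b, T.A + T.c}).sum_mem (t := Finset.univ)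
      (w := ![1 - T.X y - T.Y y, T.X y, T.Y y]) (z := ![T.A, T.A + T.b, T.A + T.c])
      (by intro i _; fin_cases i <;> simp <;> linarith) (by simp [Fin.sum_univ_three]; ring)
      (by intro i _; fin_cases i <;> [exact hA; exact hB; exact hC])
    convert this
    nth_rw 1 [T.eq_point y]
    simp [Fin.sum_univ_three]
    module

/-- A closed edge of the triangle. -/
def edge (j : Fin 3) : Set Plane := {y ∈ T.closedDomain | T.side j y = 0}

/-- The vertices of the triangle. -/
def corners : Set Plane := {T.A, T.A + T.b, T.A + T.c}

lemma frontier_domain : frontier T.domain = ⋃ j, T.edge j := by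
  rw [frontier, T.closure_domain, T.isOpen_domain.interior_eq]
  ext y
  simp only [Set.mem_sdiff, mem_iUnion, edge, mem_ofPred_eq]
  constructor
  · rintro ⟨h1, h2⟩
    by_contra hcon
    push Not at hcon
    exact h2 fun j => lt_of_le_of_ne (h1 j) (hcon j h1).symm
  · rintro ⟨j, h1, h2⟩
    exact ⟨h1, fun h3 => (h3 j).ne' h2⟩

lemma mem_corners_of_side {y : Plane} {i j : Fin 3} (hij : i ≠ j) (hi : T.side i y = 0)
    (hj : T.side j y = 0) : y ∈ T.corners := by
  have key : (T.X y = 0 ∧ T.Y y = 0) ∨ (T.X y = 1 ∧ T.Y y = 0) ∨ (T.X y = 0 ∧ T.Y y = 1) := by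
    fin_cases i <;> fin_cases j <;> simp [side] at hij hi hj ⊢
    · exact Or.inl ⟨hi, hj⟩
    · exact Or.inr (Or.inr ⟨hi, by linarith⟩)
    · exact Or.inl ⟨hj, hi⟩
    · exact Or.inr (Or.inl ⟨by linarith, hi⟩)
    · exact Or.inr (Or.inr ⟨hj, by linarith⟩)
    · exact Or.inr (Or.inl ⟨by linarith, hj⟩)
  rw [T.eq_point y]
  rcases key with h | h | h <;> simp [corners, h.1, h.2]

lemma hausdorffMeasure_corners : Measure.hausdorffMeasure 1 T.corners = 0 := by
  have := Measure.nullSingletonClass_hausdorff Plane (d := 1) one_pos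
  exact (by simp [corners] : T.corners.Finite).measure_zero _

lemma edge_eq_image (j : Fin 3) :
    T.edge j = (fun t : ℝ => T.edgeStart j + t • T.edgeDir j) '' Icc 0 1 := by
  ext y
  simp only [edge, mem_ofPred_eq, mem_closedDomain, mem_image]
  constructor
  · rintro ⟨⟨h1, h2, h3⟩, h4⟩
    fin_cases j
    · have h4 : T.X y = 0 := h4
      refine ⟨T.Y y, ⟨h2, by linarith⟩, ?_⟩
      nth_rw 2 [T.eq_point y]
      simp [edgeStart, edgeDir, h4]
    · have h4 : T.Y y = 0 := h4
      refine ⟨T.X y, ⟨h1, by linarith⟩, ?_⟩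
      nth_rw 2 [T.eq_point y]
      simp [edgeStart, edgeDir, h4]
    · have h4 : 1 - T.X y - T.Y y = 0 := h4
      have h5 : T.X y = 1 - T.Y y := by linarith
      refine ⟨T.Y y, ⟨h2, by linarith⟩, ?_⟩
      nth_rw 2 [T.eq_point y]
      simp [edgeStart, edgeDir, h5]
      module
  · rintro ⟨t, ⟨ht0, ht1⟩, rfl⟩
    have key : ∀ r s : ℝ, T.edgeStart j + t • T.edgeDir j = T.A + (r • T.b + s • T.c) →
        0 ≤ r → 0 ≤ s → r + s ≤ 1 → T.side j (T.A + (r • T.b + s • T.c)) = 0 →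
        (0 ≤ T.X (T.edgeStart j + t • T.edgeDir j) ∧ 0 ≤ T.Y (T.edgeStart j + t • T.edgeDir j) ∧
          T.X (T.edgeStart j + t • T.edgeDir j) + T.Y (T.edgeStart j + t • T.edgeDir j) ≤ 1) ∧
          T.side j (T.edgeStart j + t • T.edgeDir j) = 0 := by
      intro r s e h1 h2 h3 h4
      rw [e, X_point, Y_point]
      exact ⟨⟨h1, h2, h3⟩, h4⟩
    fin_cases j
    · exact key 0 t (by simp [edgeStart, edgeDir]) le_rfl ht0 (by linarith) (T.X_point _ _)
    · exact key t 0 (by simp [edgeStart, edgeDir]) ht0 le_rfl (by linarith) (T.Y_point _ _)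
    · refine key (1 - t) t ?_ (by linarith) ht0 (by linarith) ?_
      · simp [edgeStart, edgeDir]
        module
      · change 1 - T.X _ - T.Y _ = 0
        rw [X_point, Y_point]
        ring

/-- The outer unit normals of the three edges. -/
noncomputable def edgeNormal (j : Fin 3) : Plane := -(‖T.innerNormal j‖⁻¹ • T.innerNormal j)

/-- Away from the corners the other two side functions are positive at `y`, so along a short ray
only side `j` decides about membership. For outward rays, negativity of side `j` alone suffices. -/
lemma isOuterUnitNormal_edgeNormal {j : Fin 3} {y : Plane} (hy : y ∈ T.edge j)
    (hc : y ∉ T.corners) : IsOuterUnitNormal T.domain y (T.edgeNormal j) := by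
  have hn : 0 < ‖T.innerNormal j‖ := norm_pos_iff.2 (T.innerNormal_ne_zero j)
  have hinner : ∀ v : Plane, inner ℝ v (T.edgeNormal j) =
      -(‖T.innerNormal j‖⁻¹ * T.q * T.dSide j v) := fun v => by
    rw [edgeNormal, inner_neg_right, inner_smul_right, inner_innerNormal, mul_assoc]
  have hr : 0 < ‖T.innerNormal j‖⁻¹ * T.q := mul_pos (inv_pos.2 hn) T.q_pos
  refine ⟨?_, fun v hv => ?_, fun v hv => ?_⟩
  · rw [edgeNormal, norm_neg, norm_smul, norm_inv, norm_norm, inv_mul_cancel₀ hn.ne']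
  · rw [hinner, neg_lt_zero] at hv
    have hv' := pos_of_mul_pos_right hv hr.le
    have : ∀ᶠ t in 𝓝[>] (0 : ℝ), ∀ i, 0 < T.side i (y + t • v) := by
      rw [eventually_all]
      intro i
      by_cases hij : i = j
      · subst hij
        filter_upwards [self_mem_nhdsWithin] with t ht
        rw [side_add, hy.2, map_smul, zero_add]
        exact mul_pos (mem_Ioi.1 ht) hv'
      · have hpos : 0 < T.side i y := lt_of_le_of_ne (hy.1 i) fun h =>
          hc (T.mem_corners_of_side hij h.symm hy.2)
        have hcont : Continuous fun t : ℝ => T.side i (y + t • v) :=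
          (T.continuous_side i).comp (by fun_prop)
        have := hcont.tendsto 0
        rw [zero_smul, add_zero] at this
        exact (this.mono_left nhdsWithin_le_nhds).eventually (lt_mem_nhds hpos)
    exact this
  · rw [hinner, neg_pos] at hv
    have hv' : T.dSide j v < 0 := by
      by_contra hcon
      exact hv.not_ge (mul_nonneg hr.le (not_lt.1 hcon))
    filter_upwards [self_mem_nhdsWithin] with t ht hmem
    rw [closure_domain] at hmem
    have := hmem j
    rw [side_add, hy.2, map_smul, zero_add, smul_eq_mul] at this
    exact this.not_gt (mul_neg_of_pos_of_neg (mem_Ioi.1 ht) hv')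

lemma outerNormal_eq {j : Fin 3} {y : Plane} (hy : y ∈ T.edge j) (hc : y ∉ T.corners) :
    outerNormal T.domain y = T.edgeNormal j := by
  have h : ∃ ν, IsOuterUnitNormal T.domain y ν := ⟨_, T.isOuterUnitNormal_edgeNormal hy hc⟩
  rw [outerNormal, dif_pos h]
  exact h.choose_spec.unique (T.isOuterUnitNormal_edgeNormal hy hc)

/-! ### Evaluation of the boundary vector -/

lemma coeFn_smul_modeL2 (κ : ℂ) (m n : ℤ) :
    ∀ᵐ y ∂(volume.restrict T.domain), (κ • T.modeL2 m n) y = κ * T.mode m n y := by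
  filter_upwards [Lp.coeFn_smul κ (T.modeL2 m n), coeFn_continuousToL2 T.measurableSet_domain
    T.isBounded_domain (T.continuous_mode m n)] with y h1 h2
  rw [h1, Pi.smul_apply, modeL2, h2, smul_eq_mul]

lemma boundaryTrace_smul_modeL2 (κ : ℂ) (m n : ℤ) {y : Plane} (hy : y ∈ T.closedDomain) :
    boundaryTrace T.domain (κ • T.modeL2 m n) y = κ * T.mode m n y :=
  boundaryTrace_eq_of_continuous T.isOpen_domain T.isBounded_domain
    (continuous_const.mul (Complex.continuous_ofReal.comp (T.continuous_mode m n)))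
    (T.coeFn_smul_modeL2 κ m n) (by rwa [closure_domain])

lemma edge_subset (j : Fin 3) : T.edge j ⊆ T.closedDomain := fun _ hy => hy.1

lemma isClosed_edge (j : Fin 3) : IsClosed (T.edge j) :=
  T.isClosed_closedDomain.inter (isClosed_eq (T.continuous_side j) continuous_const)

lemma edge_integrand (κ : ℂ) (m n : ℤ) (j : Fin 3) :
    (fun y => (‖boundaryTrace T.domain (κ • T.modeL2 m n) y‖ ^ 2) • outerNormal T.domain y)
      =ᵐ[(Measure.hausdorffMeasure 1).restrict (T.edge j)]
    fun y => (‖κ‖ ^ 2 * T.mode m n y ^ 2) • T.edgeNormal j := by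
  filter_upwards [ae_restrict_mem (T.isClosed_edge j).measurableSet,
    ae_restrict_of_ae (measure_eq_zero_iff_ae_notMem.1 T.hausdorffMeasure_corners)] with y hy hc
  rw [T.outerNormal_eq hy hc, T.boundaryTrace_smul_modeL2 κ m n hy.1, norm_mul, mul_pow,
    Complex.norm_real, Real.norm_eq_abs, sq_abs]

/-- Distinct edges meet only in corners, a null set for `σ`, so the integral splits over the edges.
Parametrizing by `[0, 1]` gives the factor `‖edgeDir j‖`, which removes the normalization of
`edgeNormal j`. -/
lemma vectorX_smul_modeL2 (κ : ℂ) (m n : ℤ) :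
    vectorX T.domain (κ • T.modeL2 m n) = (-‖κ‖ ^ 2) • ∑ j,
      (∫ t in (0 : ℝ)..1, T.mode m n (T.edgeStart j + t • T.edgeDir j) ^ 2) • T.innerNormal j := by
  have hint : ∀ j, IntegrableOn (fun y =>
      (‖boundaryTrace T.domain (κ • T.modeL2 m n) y‖ ^ 2) • outerNormal T.domain y)
      (T.edge j) (Measure.hausdorffMeasure 1) := by
    intro j
    refine Integrable.congr ?_ (T.edge_integrand κ m n j).symm
    have hc : Continuous fun y => (‖κ‖ ^ 2 * T.mode m n y ^ 2) • T.edgeNormal j :=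
      (continuous_const.mul ((T.continuous_mode m n).pow 2)).smul continuous_const
    refine hc.continuousOn.integrableOn_of_subset_isCompact T.isCompact_closedDomain
      (T.isClosed_edge j).measurableSet (T.edge_subset j) ?_
    · rw [edge_eq_image]
      exact (hausdorffMeasure_image_segment_lt_top (T.edgeDir_ne_zero j)).ne
  rw [vectorX, frontier_domain, integral_iUnion_ae
    (fun j => (T.isClosed_edge j).measurableSet.nullMeasurableSet) ?_
    (integrableOn_finite_iUnion.2 hint), tsum_fintype, Finset.smul_sum]
  · refine Finset.sum_congr rfl fun j _ => ?_
    have hn : ‖T.innerNormal j‖ ≠ 0 := norm_ne_zero_iff.2 (T.innerNormal_ne_zero j)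
    rw [integral_congr_ae (T.edge_integrand κ m n j), integral_smul_const, integral_const_mul,
      edge_eq_image, setIntegral_hausdorffMeasure_segment (T.edgeDir_ne_zero j), norm_edgeDir,
      edgeNormal, smul_neg, smul_smul, smul_smul, ← neg_smul]
    congr 1
    field_simp
  · intro i j hij
    refine measure_mono_null ?_ T.hausdorffMeasure_corners
    exact fun y hy => T.mem_corners_of_side hij hy.1.2 hy.2.2

lemma mode_one_zero_point (s t : ℝ) : T.mode 1 0 (T.A + (s • T.b + t • T.c)) =
    Real.cos (Real.pi * s) - Real.cos (Real.pi * t) := by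
  rw [mode_one_zero, X_point, Y_point]

lemma integral_cos_pi : ∫ t in (0 : ℝ)..1, Real.cos (Real.pi * t) = 0 := by
  rw [intervalIntegral.integral_comp_mul_left (fun t => Real.cos t) Real.pi_ne_zero]
  simp

lemma integral_cos_pi_sq : ∫ t in (0 : ℝ)..1, Real.cos (Real.pi * t) ^ 2 = 1 / 2 := by
  rw [intervalIntegral.integral_comp_mul_left (fun t => Real.cos t ^ 2) Real.pi_ne_zero,
    integral_cos_sq]
  have := Real.pi_ne_zero
  simp
  field_simp

lemma integral_one_sub_cos_pi_sq :
    ∫ t in (0 : ℝ)..1, (1 - Real.cos (Real.pi * t)) ^ 2 = 3 / 2 := by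
  have h : ∀ t : ℝ, (1 - Real.cos (Real.pi * t)) ^ 2 =
      (1 - 2 * Real.cos (Real.pi * t)) + Real.cos (Real.pi * t) ^ 2 := fun t => by ring
  simp only [h]
  rw [intervalIntegral.integral_add, intervalIntegral.integral_sub,
    intervalIntegral.integral_const_mul, integral_cos_pi, integral_cos_pi_sq]
  · norm_num
  all_goals exact Continuous.intervalIntegrable (by fun_prop) _ _

/-- The mode restricts, up to sign, to `1 - cos πt` on the legs and to `2 cos πt` on the hypotenuse.
The weights `3/2`, `3/2`, `2` combine to `-(3/2) b - (3/2) c + 2 (b + c) = (b + c) / 2`. -/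
theorem vectorX_smul_modeL2_one (κ : ℂ) :
    vectorX T.domain (κ • T.modeL2 1 0) = (‖κ‖ ^ 2 / 2) • (T.b + T.c) := by
  rw [vectorX_smul_modeL2, Fin.sum_univ_three]
  have h0 : ∫ t in (0 : ℝ)..1, T.mode 1 0 (T.edgeStart 0 + t • T.edgeDir 0) ^ 2 = 3 / 2 := by
    rw [← integral_one_sub_cos_pi_sq]
    congr 1 with t
    have : T.edgeStart 0 + t • T.edgeDir 0 = T.A + ((0 : ℝ) • T.b + t • T.c) := by
      simp [edgeStart, edgeDir]
    rw [this, mode_one_zero_point, mul_zero, Real.cos_zero]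
  have h1 : ∫ t in (0 : ℝ)..1, T.mode 1 0 (T.edgeStart 1 + t • T.edgeDir 1) ^ 2 = 3 / 2 := by
    rw [← integral_one_sub_cos_pi_sq]
    congr 1 with t
    have : T.edgeStart 1 + t • T.edgeDir 1 = T.A + (t • T.b + (0 : ℝ) • T.c) := by
      simp [edgeStart, edgeDir]
    rw [this, mode_one_zero_point, mul_zero, Real.cos_zero]
    ring
  have h2 : ∫ t in (0 : ℝ)..1, T.mode 1 0 (T.edgeStart 2 + t • T.edgeDir 2) ^ 2 = 2 := by
    have h : ∀ t : ℝ, T.mode 1 0 (T.edgeStart 2 + t • T.edgeDir 2) ^ 2 =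
        4 * Real.cos (Real.pi * t) ^ 2 := by
      intro t
      have : T.edgeStart 2 + t • T.edgeDir 2 = T.A + ((1 - t) • T.b + t • T.c) := by
        simp [edgeStart, edgeDir]
        module
      rw [this, mode_one_zero_point, mul_sub, mul_one, Real.cos_pi_sub]
      ring
    simp only [h]
    rw [intervalIntegral.integral_const_mul, integral_cos_pi_sq]
    norm_num
  rw [h0, h1, h2]
  simp only [innerNormal, Matrix.cons_val]
  module

lemma exists_eq_smul_of_mem_eigenspace {ψ : L2 T.domain}
    (h : ψ ∈ neumannEigenspace T.domain T.gap) : ∃ κ : ℂ, ψ = κ • T.modeL2 1 0 := by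
  rw [eigenspace_gap, Submodule.mem_span_singleton] at h
  obtain ⟨κ, hκ⟩ := h
  exact ⟨κ, hκ.symm⟩

lemma b_add_c_ne_zero : T.b + T.c ≠ 0 := by
  have := T.innerNormal_ne_zero 2
  exact neg_ne_zero.1 this

lemma vectorX_ne_zero {ψ : L2 T.domain} (h : ψ ∈ neumannEigenspace T.domain T.gap) (h0 : ψ ≠ 0) :
    vectorX T.domain ψ ≠ 0 := by
  obtain ⟨κ, rfl⟩ := T.exists_eq_smul_of_mem_eigenspace h
  rw [vectorX_smul_modeL2_one]
  have hκ : κ ≠ 0 := by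
    rintro rfl
    exact h0 (zero_smul _ _)
  exact smul_ne_zero (div_ne_zero (pow_ne_zero _ (norm_ne_zero_iff.2 hκ)) two_ne_zero)
    T.b_add_c_ne_zero

lemma sq_norm_smul_modeL2_one (κ : ℂ) :
    ‖κ • T.modeL2 1 0‖ ^ 2 = ‖κ‖ ^ 2 * volume.real T.domain := by
  rw [norm_smul, mul_pow, norm_sq_modeL2_one]

/-! ### The reference triangle and the conclusion -/

/-- The frame of the reference triangle. -/
noncomputable def reference : IsoFrame where
  A := !₂[0, 0]
  b := !₂[1, 0]
  c := !₂[0, 1]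
  q := 1
  q_pos := one_pos
  ortho := by simp
  sq_b := by simp
  sq_c := by simp

lemma reference_X (y : Plane) : reference.X y = y 0 := by
  simp [X, dX_apply, reference]

lemma reference_Y (y : Plane) : reference.Y y = y 1 := by
  simp [Y, dY_apply, reference]

lemma reference_gap : reference.gap = Real.pi ^ 2 := by
  simp [gap, reference]

lemma referenceTriangle_eq : referenceTriangle = reference.domain := by
  rw [← openTriangle_eq, referenceTriangle]
  congr 1 <;> ext i <;> fin_cases i <;> simp [reference]

lemma volume_real_reference : volume.real reference.domain = 1 / 2 := by
  let e := (MeasurableEquiv.toLp 2 (Fin 2 → ℝ)).symm.trans MeasurableEquiv.finTwoArrow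
  have he : MeasurePreserving e volume volume :=
    (EuclideanSpace.volume_preserving_symm_measurableEquiv_toLp (Fin 2)).trans
      (volume_preserving_finTwoArrow ℝ)
  have hpre : reference.domain = e ⁻¹' regionBetween (fun _ => 0) (fun x => 1 - x) (Ioo 0 1) := by
    ext y
    have h0 : (e y).1 = y 0 := rfl
    have h1 : (e y).2 = y 1 := rfl
    rw [mem_domain, reference_X, reference_Y, mem_preimage, regionBetween, mem_ofPred_eq, h0, h1,
      mem_Ioo, mem_Ioo]
    constructor
    · rintro ⟨h2, h3, h4⟩
      exact ⟨⟨h2, by linarith⟩, h3, by linarith⟩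
    · rintro ⟨⟨h2, -⟩, h3, h4⟩
      exact ⟨h2, h3, by linarith⟩
  rw [hpre, measureReal_def, he.measure_preimage_equiv, Measure.volume_eq_prod,
    volume_regionBetween_eq_integral]
  · have : ∫ x in Ioo (0 : ℝ) 1, ((fun x : ℝ => 1 - x) - fun _ : ℝ => (0 : ℝ)) x = 1 / 2 := by
      rw [← integral_Ioc_eq_integral_Ioo, ← intervalIntegral.integral_of_le zero_le_one]
      simp only [Pi.sub_apply, sub_zero]
      rw [intervalIntegral.integral_sub (by simp) (by simp), integral_id]
      norm_num
    rw [this, ENNReal.toReal_ofReal (by norm_num)]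
  · exact (continuous_const.integrableOn_Icc).mono_set Ioo_subset_Icc_self
  · exact ((continuous_const.sub continuous_id).integrableOn_Icc).mono_set Ioo_subset_Icc_self
  · exact measurableSet_Ioo
  · intro x hx
    exact sub_nonneg.2 hx.2.le

end IsoFrame

lemma IsIsoscelesRightTriangle.exists_isoFrame {ω : Set Plane} (h : IsIsoscelesRightTriangle ω) :
    ∃ T : IsoFrame, ω = T.domain := by
  obtain ⟨A, B, C, hne, hort, hdist, rfl⟩ := h
  have hb : ‖B - A‖ ^ 2 = (B - A) 0 ^ 2 + (B - A) 1 ^ 2 := by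
    rw [EuclideanSpace.real_norm_sq_eq, Fin.sum_univ_two]
  have hc : ‖C - A‖ ^ 2 = (C - A) 0 ^ 2 + (C - A) 1 ^ 2 := by
    rw [EuclideanSpace.real_norm_sq_eq, Fin.sum_univ_two]
  have hbc : ‖B - A‖ = ‖C - A‖ := by
    rw [← dist_eq_norm, ← dist_eq_norm, dist_comm B, dist_comm C, hdist]
  let T : IsoFrame :=
    { A := A
      b := B - A
      c := C - A
      q := ‖B - A‖ ^ 2
      q_pos := pow_pos (norm_pos_iff.2 (sub_ne_zero.2 hne.symm)) 2
      ortho := by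
        rw [PiLp.inner_apply, Fin.sum_univ_two] at hort
        simp only [RCLike.inner_apply, conj_trivial] at hort
        linarith
      sq_b := hb.symm
      sq_c := by rw [hbc]; exact hc.symm }
  refine ⟨T, ?_⟩
  rw [← T.openTriangle_eq]
  change _ = openTriangle A (A + (B - A)) (A + (C - A))
  rw [add_sub_cancel, add_sub_cancel]

theorem proposition5p1 :
    (∀ ω : Set Plane, IsIsoscelesRightTriangle ω →
      0 < neumannEigenvalue ω 2 ∧
      Module.finrank ℂ (neumannEigenspace ω (neumannEigenvalue ω 2)) = 1 ∧
      ∀ ψ ∈ neumannEigenspace ω (neumannEigenvalue ω 2), ‖ψ‖ = 1 → vectorX ω ψ ≠ 0) ∧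
    neumannEigenvalue referenceTriangle 2 = Real.pi ^ 2 ∧
    Module.finrank ℂ (neumannEigenspace referenceTriangle (Real.pi ^ 2)) = 1 ∧
    (∃ ψ ∈ neumannEigenspace referenceTriangle (Real.pi ^ 2), ‖ψ‖ = 1 ∧
      ∀ᵐ y ∂(volume.restrict referenceTriangle),
        ψ y = ((Real.sqrt 2 * (Real.cos (Real.pi * y 1) - Real.cos (Real.pi * y 0)) : ℝ) : ℂ)) ∧
    (∀ ψ ∈ neumannEigenspace referenceTriangle (Real.pi ^ 2), ‖ψ‖ = 1 →
      vectorX referenceTriangle ψ = !₂[1, 1]) := by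
  refine ⟨?_, ?_⟩
  · intro ω hω
    obtain ⟨T, rfl⟩ := hω.exists_isoFrame
    rw [T.neumannEigenvalue_two]
    refine ⟨T.gap_pos, T.finrank_eigenspace_gap, fun ψ hψ hn => T.vectorX_ne_zero hψ ?_⟩
    rintro rfl
    simp at hn
  · rw [IsoFrame.referenceTriangle_eq, ← IsoFrame.reference_gap]
    refine ⟨IsoFrame.reference.neumannEigenvalue_two, IsoFrame.reference.finrank_eigenspace_gap,
      -- The minus sign is needed because `mode 1 0` is `cos πy₁ - cos πy₂`, opposite to the
      -- required function.
      ⟨((-Real.sqrt 2 : ℝ) : ℂ) • IsoFrame.reference.modeL2 1 0, ?_, ?_, ?_⟩, ?_⟩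
    · rw [IsoFrame.eigenspace_gap]
      exact Submodule.smul_mem _ _ (Submodule.mem_span_singleton_self _)
    · have h := IsoFrame.reference.sq_norm_smul_modeL2_one ((-Real.sqrt 2 : ℝ) : ℂ)
      rw [IsoFrame.volume_real_reference, Complex.norm_real, Real.norm_eq_abs, sq_abs, neg_sq,
        Real.sq_sqrt zero_le_two] at h
      exact (pow_eq_one_iff_of_nonneg (norm_nonneg _) two_ne_zero).1 (h.trans (by norm_num))
    · filter_upwards [IsoFrame.reference.coeFn_smul_modeL2 ((-Real.sqrt 2 : ℝ) : ℂ) 1 0] with y hy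
      rw [hy, IsoFrame.mode_one_zero, IsoFrame.reference_X, IsoFrame.reference_Y]
      push_cast
      ring
    · intro ψ hψ hn
      obtain ⟨κ, rfl⟩ := IsoFrame.reference.exists_eq_smul_of_mem_eigenspace hψ
      have h := IsoFrame.reference.sq_norm_smul_modeL2_one κ
      rw [hn, IsoFrame.volume_real_reference] at h
      -- The squared norm of `modeL2 1 0` equals the area `1/2`, so normalization fixes `|κ|`
      -- whatever the phase of `κ`.
      have hκ : ‖κ‖ ^ 2 / 2 = 1 := by linarith
      rw [IsoFrame.vectorX_smul_modeL2_one, hκ, one_smul]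
      ext i
      fin_cases i <;> simp [IsoFrame.reference]
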